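/- For $n\ge 0$ let $\alpha_n=(-4)^{-n}\binom{2n}{n}$. For a real $p>1$ (for instance a prime) put $$\Sigma_p(x)=\sum_{m\ge 1}\frac{1}{\sqrt{p^{2m}e^{x}+e^{-x}}},\qquad c(2k,p)=(-1)^k\,\partial_x^{2k}\Big(\frac1{\sqrt{e^{-x}+e^{x}}}+\Sigma_p(x)+\Sigma_p(-x)\Big)_{x=0},\qquad c(2k+1,p)=0 .$$ Let $(P_n)$ be the polynomials with positive leading coefficients obtained by Gram–Schmidt orthonormalization of the powers of $X$ for the inner product of real polynomials given by $\langle X^i|X^j\rangle=c(i+j,p)$, let $a(n)=\langle XP_n|P_{n+1}\rangle$ be the associated Jacobi coefficients, and let $A$ be the Jacobi matrix, $Ae_n=a(n-1)e_{n-1}+a(n)e_{n+1}$ with $a(-1)=0$. Let $N e_n=n e_n$, let $E_+=\frac14+N+\frac1{2i}[A,N]$, and let $d_n$ be the diagonal entries of the diagonal matrix $D=[A,E_+]-2iE_+$; explicitly $-i\,d_n=-2n-\frac12+a(n)^2-a(n-1)^2$. Consider $-i\,d_n$ as a function of $q=1/p$. Let $$Y_n={}_2F_1\big(1,n+\tfrac12;n+1;-1\big)=\sum_{k\ge0}\frac{(1)_k\,(n+\frac12)_k}{(n+1)_k}\,\frac{(-1)^k}{k!},$$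 a (conditionally) convergent series. Then for every integer $n\ge 0$ the function $-i\,d_n$ of $q$ is, for all sufficiently small $q>0$, the sum of a convergent power series $\sum_{j\ge0}\delta_jq^j$ with real coefficients, in which $\delta_0=0$, $\delta_1=-\frac{16n^2+8n+3}{\sqrt2}\,\alpha_n$, and $$\delta_2=\Big(8n^2+22n+6-(16n^2+8n+3)\,Y_n\Big)\alpha_n^2 .$$ In particular, as $q\to0^+$, $$-i\,d_n=-\frac{16n^2+8n+3}{\sqrt2}\,\alpha_n\,q+\Big(8n^2+22n+6-(16n^2+8n+3)\,Y_n\Big)\alpha_n^2\,q^2+O(q^3).$$ -/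

import Mathlib

open Filter Topology Asymptotics

namespace SemilocalJacobi

noncomputable section

/-! Moments attached to the pair of places `{p, ∞}` -/

/-- `Σ_p(x) = ∑_{m > 0} 1 / √(p^{2m} e^x + e^{-x})`. -/
def primeSeries (p x : ℝ) : ℝ :=
  ∑' m : ℕ, 1 / √(p ^ (2 * (m + 1)) * Real.exp x + Real.exp (-x))

/-- The generating function `1 / √(e^{-x} + e^x) + Σ_p(x) + Σ_p(-x)` of the moments. -/
def momentGenerating (p x : ℝ) : ℝ :=
  1 / √(Real.exp (-x) + Real.exp x) + primeSeries p x + primeSeries p (-x)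

/-- The moments `c(j, p)`: they vanish for odd `j`, and `c(2k, p)` is `(-1)^k` times the derivative
of order `2k` of the generating function at `0`. -/
def moment (p : ℝ) (j : ℕ) : ℝ :=
  if Even j then (-1) ^ (j / 2) * iteratedDeriv j (momentGenerating p) 0 else 0

/-- The linear functional on polynomials ("integration") with moments `c(j, p)`. -/
def momentFunctional (p : ℝ) (f : Polynomial ℝ) : ℝ :=
  f.sum fun j b => b * moment p j

/-! Orthogonal polynomials and Jacobi coefficients of a moment functional `L`, the inner product
of `f` and `g` being `L (f * g)` -/

/-- The monic orthogonal polynomials, by Gram-Schmidt orthogonalization of the powers of `X`. -/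
def monicOrthogonal (L : Polynomial ℝ → ℝ) : ℕ → Polynomial ℝ
  | n => Polynomial.X ^ n - ∑ k : Fin n,
      Polynomial.C (L (Polynomial.X ^ n * monicOrthogonal L k) / L (monicOrthogonal L k ^ 2))
        * monicOrthogonal L k
termination_by n => n
decreasing_by all_goals exact k.isLt

/-- The orthonormal polynomials `P_n`, with positive leading coefficient. -/
def orthonormalPoly (L : Polynomial ℝ → ℝ) (n : ℕ) : Polynomial ℝ :=
  Polynomial.C (1 / √(L (monicOrthogonal L n ^ 2))) * monicOrthogonal L n

/-- The Jacobi coefficients `a(n) = ⟨X P_n | P_{n+1}⟩`. -/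
def jacobiCoeff (L : Polynomial ℝ → ℝ) (n : ℕ) : ℝ :=
  L (Polynomial.X * orthonormalPoly L n * orthonormalPoly L (n + 1))

/-! The Jacobi matrix and the diagonal matrix `D`, acting on finitely supported sequences with
basis `e_n = Finsupp.single n 1` -/

/-- The Jacobi matrix: `A e_n = a(n-1) e_{n-1} + a(n) e_{n+1}`, with `A e_0 = a(0) e_1`. -/
def jacobiOp (a : ℕ → ℝ) : Module.End ℂ (ℕ →₀ ℂ) :=
  Finsupp.linearCombination ℂ fun n =>
    (match n with
      | 0 => 0
      | m + 1 => Finsupp.single m (a m : ℂ)) + Finsupp.single (n + 1) (a n : ℂ)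

/-- The integer grading: `N e_n = n e_n`. -/
def gradingOp : Module.End ℂ (ℕ →₀ ℂ) :=
  Finsupp.linearCombination ℂ fun n => Finsupp.single n (n : ℂ)

/-- `E₊ = 1/4 + N + (1/2i) [A, N]`. -/
def ePlus (a : ℕ → ℝ) : Module.End ℂ (ℕ →₀ ℂ) :=
  (1 / 4 : ℂ) • 1 + gradingOp + (1 / (2 * Complex.I)) • ⁅jacobiOp a, gradingOp⁆

/-- `D = [A, E₊] - 2i E₊`. -/
def diagOp (a : ℕ → ℝ) : Module.End ℂ (ℕ →₀ ℂ) :=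
  ⁅jacobiOp a, ePlus a⁆ - (2 * Complex.I) • ePlus a

/-- Explicit action of `D`, with `a(-1) = 0`. -/
theorem diagOp_aux (a : ℕ → ℝ) (n : ℕ) :
    diagOp a (Finsupp.single n 1) = Finsupp.single n (Complex.I *
      (-2 * n - 1 / 2 + (a n : ℂ) ^ 2 - (if n = 0 then 0 else (a (n - 1) : ℂ) ^ 2))) := by
  have hI : Complex.I ^ 2 = -1 := Complex.I_sq
  have hinv : (1 / (2 * Complex.I)) = -Complex.I / 2 := by
    rw [div_eq_div_iff (by simp) (by norm_num)]; linear_combination (2 : ℂ) * hI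
  rcases n with _ | _ | m <;>
  · simp only [diagOp, ePlus, jacobiOp, gradingOp, hinv, Ring.lie_def, LinearMap.sub_apply,
      LinearMap.add_apply, LinearMap.smul_apply, Module.End.mul_apply, Module.End.one_apply,
      Finsupp.linearCombination_single, map_add, map_sub, one_smul, zero_add,
      smul_add, smul_sub, Finsupp.smul_single, smul_eq_mul]
    ext j
    simp only [Finsupp.add_apply, Finsupp.sub_apply, Finsupp.single_apply]
    push_cast
    split_ifs <;> first | omega | skip
    all_goals simp at *
    all_goals try ring_nf
    all_goals try simp

/-- The diagonal entries `d_n` of `D`. -/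
def diagEntry (a : ℕ → ℝ) (n : ℕ) : ℂ :=
  diagOp a (Finsupp.single n 1) n

/-- The operator `D` is diagonal. -/
theorem diagOp_single (a : ℕ → ℝ) (n : ℕ) :
    diagOp a (Finsupp.single n 1) = Finsupp.single n (diagEntry a n) := by
  rw [diagEntry, diagOp_aux, Finsupp.single_eq_same]

/-- The usual formula for the diagonal entries, with `a(-1) = 0`. -/
theorem neg_I_mul_diagEntry (a : ℕ → ℝ) (n : ℕ) :
    -Complex.I * diagEntry a n =
      -2 * n - 1 / 2 + (a n : ℂ) ^ 2 - (if n = 0 then 0 else (a (n - 1) : ℂ) ^ 2) := by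
  rw [diagEntry, diagOp_aux, Finsupp.single_eq_same, ← mul_assoc]
  simp

/-- `d_n` as a function of `q = 1/p`, for the Jacobi matrix of the moments `c(j, p)`. -/
def dq (n : ℕ) (q : ℝ) : ℂ :=
  diagEntry (jacobiCoeff (momentFunctional q⁻¹)) n

/-! The explicit coefficients -/

/-- `α_n = (-4)^{-n} binom(2n, n)`. -/
def alpha (n : ℕ) : ℝ := ((-4 : ℝ) ^ n)⁻¹ * ((2 * n).choose n : ℝ)

/-- The `k`-th term `(a)_k (b)_k / (c)_k · z^k / k!` of the series `₂F₁(a, b; c; z)`. -/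
def hypergeomTerm (a b c z : ℝ) (k : ℕ) : ℝ :=
  (ascPochhammer ℝ k).eval a * (ascPochhammer ℝ k).eval b / (ascPochhammer ℝ k).eval c
    * (z ^ k / (k.factorial : ℝ))

end

end SemilocalJacobi

namespace SemilocalJacobi

/-! ### The coefficients `α_n` -/

/-! Expanding each term of Σ_p by the binomial series of (1+z)^(-1/2), whose coefficients are the
α_k, turns Σ_p(x) + Σ_p(-x) into a combination of the exponentials e^(±(2k+1/2)x) with weights α_k
q^(2k+1)/(1-q^(2k+1)). The moment functional is therefore the archimedean one plus point masses at
±i(2k+1/2), and modulo q^3 only the pair ±i/2 survives, with weight ε = q + q^2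
(`congrCube_moment`).

The archimedean functional has explicit monic orthogonal polynomials b_n (`basePoly`), and b_n(±i/2)
= (±i)^n n! |α_n|. Two point masses are a perturbation of rank two, so the perturbed Gram
determinants reduce to a 2×2 determinant in the sums over i < n of α_i and of |α_i|, the latter
being 2n|α_n| (`det_perturbed`).

Since a(n)^2 is a ratio of Gram determinants (`jacobiCoeff_sq`), its expansion follows. At q = 0 it
equals (n+1)(n+1/2), whence δ_0 = 0. The number Y_n enters because α_n Y_n is the tail from index n
of the series ∑ α_i = 1/√2 (`tendsto_sum_alpha`).

Congruences modulo q^3 carry an analytic cofactor, so that one computation yields both the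
convergent power series and its first three coefficients. -/

theorem alpha_zero : alpha 0 = 1 := by simp [alpha]

theorem alpha_succ (n : ℕ) : alpha (n + 1) = -(alpha n * ((n + 1 / 2) / (n + 1))) := by
  have h := Nat.succ_mul_centralBinom_succ n
  rw [Nat.centralBinom_eq_two_mul_choose, Nat.centralBinom_eq_two_mul_choose] at h
  have h' : ((n : ℝ) + 1) * ((2 * (n + 1)).choose (n + 1) : ℝ)
      = 2 * (2 * n + 1) * ((2 * n).choose n : ℝ) := by exact_mod_cast h
  have hn : (n : ℝ) + 1 ≠ 0 := by positivity
  have h4 : ((-4 : ℝ) ^ n) ≠ 0 := by positivity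
  rw [alpha, alpha, pow_succ]
  field_simp
  linear_combination (-2 : ℝ) * h'

theorem abs_alpha_succ (n : ℕ) : |alpha (n + 1)| = |alpha n| * ((n + 1 / 2) / (n + 1)) := by
  rw [alpha_succ, abs_neg, abs_mul, abs_of_nonneg (a := ((n : ℝ) + 1 / 2) / (n + 1))]
  positivity

theorem alpha_eq_neg_one_pow_mul (n : ℕ) : alpha n = (-1) ^ n * |alpha n| := by
  induction n with
  | zero => simp [alpha_zero]
  | succ n ih =>
    rw [abs_alpha_succ, alpha_succ]
    nth_rewrite 1 [ih]
    ring

theorem alpha_ne_zero (n : ℕ) : alpha n ≠ 0 := by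
  have : 0 < (2 * n).choose n := Nat.choose_pos (by omega)
  rw [alpha]
  positivity

theorem antitone_abs_alpha : Antitone fun n => |alpha n| := by
  refine antitone_nat_of_succ_le fun n => ?_
  rw [abs_alpha_succ]
  refine mul_le_of_le_one_right (abs_nonneg _) ?_
  rw [div_le_one (by positivity)]
  linarith

theorem abs_alpha_le_one (n : ℕ) : |alpha n| ≤ 1 := by
  simpa [alpha_zero] using antitone_abs_alpha (Nat.zero_le n)

theorem abs_alpha_sq_le (n : ℕ) : |alpha n| ^ 2 ≤ 1 / ((n : ℝ) + 1) := by
  -- The factor 2n+1 makes the quantity nonincreasing under the recurrence, because (2n+1)(2n+3) ≤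
  -- 4(n+1)^2.
  have h : |alpha n| ^ 2 * (2 * n + 1) ≤ 1 := by
    induction n with
    | zero => simp [alpha_zero]
    | succ n ih =>
      refine le_trans ?_ ih
      rw [abs_alpha_succ, mul_pow, mul_assoc]
      refine mul_le_mul_of_nonneg_left ?_ (by positivity)
      rw [div_pow, div_mul_eq_mul_div, div_le_iff₀ (by positivity)]
      push_cast
      nlinarith [(Nat.cast_nonneg n : (0 : ℝ) ≤ n)]
  rw [le_div_iff₀ (by positivity)]
  nlinarith [sq_nonneg |alpha n|, (Nat.cast_nonneg n : (0 : ℝ) ≤ n),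
    mul_nonneg (sq_nonneg |alpha n|) (Nat.cast_nonneg n : (0 : ℝ) ≤ n)]

theorem tendsto_abs_alpha : Tendsto (fun n => |alpha n|) atTop (𝓝 0) := by
  have h : Tendsto (fun n => |alpha n| ^ 2) atTop (𝓝 0) :=
    squeeze_zero (fun n => by positivity) abs_alpha_sq_le tendsto_one_div_add_atTop_nhds_zero_nat
  have := h.sqrt
  simpa only [Real.sqrt_sq (abs_nonneg _), Real.sqrt_zero] using this

theorem choose_neg_half (n : ℕ) : Ring.choose (-(1 / 2) : ℝ) n = alpha n := by
  induction n with
  | zero => simp [alpha_zero]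
  | succ n ih =>
    rw [alpha_succ, ← ih, Ring.choose_eq_smul, Ring.choose_eq_smul]
    simp only [smul_eq_mul]
    rw [descPochhammer_succ_right, Nat.factorial_succ]
    have h1 : (n.factorial : ℝ) ≠ 0 := by positivity
    have hn : (n : ℝ) + 1 ≠ 0 := by positivity
    simp only [Polynomial.smeval_mul, Polynomial.smeval_sub, Polynomial.smeval_X, Polynomial.smeval_natCast]
    push_cast
    field_simp
    simp
    ring

theorem hasSum_alpha {z : ℝ} (hz : |z| < 1) :
    HasSum (fun k => alpha k * z ^ k) (1 / √(1 + z)) := by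
  have h := (Real.one_add_rpow_hasFPowerSeriesOnBall_zero (a := -(1 / 2))).hasSum (y := z)
    (by simpa [← ofReal_norm, enorm_eq_nnnorm, ← NNReal.coe_lt_coe] using hz)
  have hpos : 0 ≤ 1 + z := by linarith [(abs_lt.mp hz).1]
  have h2 : (1 + z) ^ (-(1 / 2) : ℝ) = 1 / √(1 + z) := by
    rw [Real.rpow_neg hpos, ← Real.sqrt_eq_rpow, one_div]
  simpa only [zero_add, h2, binomialSeries, FormalMultilinearSeries.ofScalars_apply_eq,
    choose_neg_half, smul_eq_mul] using h

/-- The point z = 1 is on the boundary of the disc: Leibniz's criterion gives convergence, and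
Abel's limit theorem identifies the limit. -/
theorem tendsto_sum_alpha :
    Tendsto (fun n => ∑ i ∈ Finset.range n, alpha i) atTop (𝓝 (1 / √2)) := by
  obtain ⟨l, hl⟩ := antitone_abs_alpha.tendsto_alternating_series_of_tendsto_zero tendsto_abs_alpha
  simp only [← alpha_eq_neg_one_pow_mul] at hl
  have h1 := Real.tendsto_tsum_powerSeries_nhdsWithin_lt hl
  have h2 : Tendsto (fun z : ℝ => 1 / √(1 + z)) (𝓝[<] 1) (𝓝 (1 / √(1 + 1))) := by
    refine (ContinuousAt.tendsto ?_).mono_left nhdsWithin_le_nhds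
    refine ContinuousAt.div (by fun_prop) (by fun_prop) (by positivity)
  have h3 : Tendsto (fun x : ℝ => ∑' n, alpha n * x ^ n) (𝓝[<] 1) (𝓝 (1 / √(1 + 1))) := by
    refine h2.congr' ?_
    have : Set.Ioo (0 : ℝ) 1 ∈ 𝓝[<] (1 : ℝ) := Ioo_mem_nhdsLT (by norm_num)
    filter_upwards [this] with z hz
    exact (hasSum_alpha (abs_lt.mpr ⟨by linarith [hz.1], hz.2⟩)).tsum_eq.symm
  have := tendsto_nhds_unique h1 h3
  rw [this] at hl
  norm_num at hl ⊢
  exact hl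

/-- Both sides have the same ratio of consecutive terms in k. Partial sums of the hypergeometric
series thus become blocks of ∑ α_i. -/
theorem alpha_mul_hypergeomTerm (n k : ℕ) :
    alpha n * hypergeomTerm 1 ((n : ℝ) + 1 / 2) ((n : ℝ) + 1) (-1) k = alpha (n + k) := by
  induction k with
  | zero => simp [hypergeomTerm]
  | succ k ih =>
    rw [← add_assoc, alpha_succ, ← ih, hypergeomTerm, hypergeomTerm]
    have h1 : (k.factorial : ℝ) ≠ 0 := by positivity
    have h2 : (ascPochhammer ℝ k).eval ((n : ℝ) + 1) ≠ 0 :=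
      (ascPochhammer_pos k _ (by positivity)).ne'
    have h3 : (n : ℝ) + k + 1 ≠ 0 := by positivity
    have h4 : (k : ℝ) + 1 ≠ 0 := by positivity
    have h5 : (n : ℝ) + 1 + k ≠ 0 := by positivity
    simp only [ascPochhammer_succ_eval, ascPochhammer_eval_one, Nat.factorial_succ]
    push_cast
    field_simp
    ring

/-- The value of the hypergeometric series, from `∑ α_j = 1 / √2`. -/
theorem tendsto_sum_hypergeomTerm (n : ℕ) :
    Tendsto (fun K : ℕ => ∑ k ∈ Finset.range K,
      hypergeomTerm 1 ((n : ℝ) + 1 / 2) ((n : ℝ) + 1) (-1) k) atTop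
      (𝓝 ((1 / √2 - ∑ i ∈ Finset.range n, alpha i) / alpha n)) := by
  have h : ∀ K : ℕ, ∑ k ∈ Finset.range K,
      hypergeomTerm 1 ((n : ℝ) + 1 / 2) ((n : ℝ) + 1) (-1) k
      = (∑ i ∈ Finset.range (K + n), alpha i - ∑ i ∈ Finset.range n, alpha i) / alpha n := by
    intro K
    rw [add_comm K n, Finset.sum_range_add, add_sub_cancel_left, eq_div_iff (alpha_ne_zero n),
      mul_comm, Finset.mul_sum]
    exact Finset.sum_congr rfl fun k _ => alpha_mul_hypergeomTerm n k
  simp only [h]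
  exact (((tendsto_add_atTop_iff_nat n).mpr tendsto_sum_alpha).sub_const _).div_const _

/-- The sum telescopes: 2(n+1)|α_{n+1}| = (2n+1)|α_n|. -/
theorem sum_abs_alpha (n : ℕ) :
    ∑ i ∈ Finset.range n, |alpha i| = 2 * n * |alpha n| := by
  induction n with
  | zero => simp
  | succ n ih =>
    rw [Finset.sum_range_succ, ih, abs_alpha_succ]
    have hn : (n : ℝ) + 1 ≠ 0 := by positivity
    push_cast
    field_simp

/-! ### Congruence modulo `q ^ 3` of functions of a small parameter `q > 0` -/

/-- `F` agrees for small `q > 0` with the analytic function `G`, up to `q ^ 3` times an analytic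
function. -/
def CongrCube (F G : ℝ → ℝ) : Prop :=
  AnalyticAt ℝ G 0 ∧ ∃ W : ℝ → ℝ, AnalyticAt ℝ W 0 ∧ ∀ᶠ q in 𝓝[>] (0 : ℝ), F q = G q + q ^ 3 * W q

namespace CongrCube

theorem refl {G : ℝ → ℝ} (hG : AnalyticAt ℝ G 0) : CongrCube G G :=
  ⟨hG, 0, analyticAt_const, by simp⟩

theorem const (c : ℝ) : CongrCube (fun _ => c) (fun _ => c) := refl analyticAt_const

theorem congr_left {F F' G : ℝ → ℝ} (h : CongrCube F G) (hF : ∀ᶠ q in 𝓝[>] (0 : ℝ), F' q = F q) :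
    CongrCube F' G := by
  obtain ⟨hG, W, hW, h⟩ := h
  exact ⟨hG, W, hW, by filter_upwards [h, hF] with q h1 h2 using h2.trans h1⟩

theorem congr_right {F G H : ℝ → ℝ} (h : CongrCube F G) (hG : ∀ q, G q = H q) : CongrCube F H :=
  (funext hG : G = H) ▸ h

theorem add {F₁ F₂ G₁ G₂ : ℝ → ℝ} (h₁ : CongrCube F₁ G₁) (h₂ : CongrCube F₂ G₂) :
    CongrCube (fun q => F₁ q + F₂ q) (fun q => G₁ q + G₂ q) := by
  obtain ⟨hG₁, W₁, hW₁, h₁⟩ := h₁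
  obtain ⟨hG₂, W₂, hW₂, h₂⟩ := h₂
  refine ⟨hG₁.add hG₂, _, hW₁.add hW₂, ?_⟩
  filter_upwards [h₁, h₂] with q h₁ h₂
  simp only [h₁, h₂, Pi.add_apply]
  ring

theorem mul {F₁ F₂ G₁ G₂ : ℝ → ℝ} (h₁ : CongrCube F₁ G₁) (h₂ : CongrCube F₂ G₂) :
    CongrCube (fun q => F₁ q * F₂ q) (fun q => G₁ q * G₂ q) := by
  obtain ⟨hG₁, W₁, hW₁, h₁⟩ := h₁
  obtain ⟨hG₂, W₂, hW₂, h₂⟩ := h₂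
  refine ⟨hG₁.mul hG₂, fun q => W₁ q * G₂ q + G₁ q * W₂ q + q ^ 3 * (W₁ q * W₂ q), by fun_prop, ?_⟩
  filter_upwards [h₁, h₂] with q h₁ h₂
  rw [h₁, h₂]
  ring

theorem const_mul (c : ℝ) {F G : ℝ → ℝ} (h : CongrCube F G) :
    CongrCube (fun q => c * F q) (fun q => c * G q) := (const c).mul h

theorem sub {F₁ F₂ G₁ G₂ : ℝ → ℝ} (h₁ : CongrCube F₁ G₁) (h₂ : CongrCube F₂ G₂) :
    CongrCube (fun q => F₁ q - F₂ q) (fun q => G₁ q - G₂ q) := by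
  simpa [sub_eq_add_neg] using h₁.add (h₂.const_mul (-1))

theorem inv {F G : ℝ → ℝ} (h : CongrCube F G) (h0 : G 0 ≠ 0) :
    CongrCube (fun q => (F q)⁻¹) (fun q => (G q)⁻¹) := by
  obtain ⟨hG, W, hW, h⟩ := h
  have hF : AnalyticAt ℝ (fun q => G q + q ^ 3 * W q) 0 := by fun_prop
  have hF0 : G 0 + 0 ^ 3 * W 0 ≠ 0 := by simpa using h0
  -- From 1/(G + q^3 W) - 1/G = -q^3 W / (G (G + q^3 W)).
  refine ⟨hG.fun_inv h0, fun q => -(W q) * ((G q)⁻¹ * (G q + q ^ 3 * W q)⁻¹),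
    hW.neg.mul ((hG.fun_inv h0).mul (hF.fun_inv hF0)), ?_⟩
  have e1 := hG.continuousAt.eventually_ne h0
  have e2 := hF.continuousAt.eventually_ne hF0
  filter_upwards [h, e1.filter_mono nhdsWithin_le_nhds, e2.filter_mono nhdsWithin_le_nhds]
    with q h e1 e2
  rw [h]
  field_simp
  ring

theorem div {F₁ F₂ G₁ G₂ : ℝ → ℝ} (h₁ : CongrCube F₁ G₁) (h₂ : CongrCube F₂ G₂) (h0 : G₂ 0 ≠ 0) :
    CongrCube (fun q => F₁ q / F₂ q) (fun q => G₁ q / G₂ q) := by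
  simpa only [div_eq_mul_inv] using h₁.mul (h₂.inv h0)

theorem sum {ι : Type*} (s : Finset ι) {F G : ι → ℝ → ℝ} (h : ∀ i ∈ s, CongrCube (F i) (G i)) :
    CongrCube (fun q => ∑ i ∈ s, F i q) (fun q => ∑ i ∈ s, G i q) := by
  classical
  induction s using Finset.induction_on with
  | empty => simpa using const 0
  | insert a s ha ih =>
    simpa only [Finset.sum_insert ha] using
      (h a (by simp)).add (ih fun i hi => h i (by simp [hi]))

theorem prod {ι : Type*} (s : Finset ι) {F G : ι → ℝ → ℝ} (h : ∀ i ∈ s, CongrCube (F i) (G i)) :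
    CongrCube (fun q => ∏ i ∈ s, F i q) (fun q => ∏ i ∈ s, G i q) := by
  classical
  induction s using Finset.induction_on with
  | empty => simpa using const 1
  | insert a s ha ih =>
    simpa only [Finset.prod_insert ha] using
      (h a (by simp)).mul (ih fun i hi => h i (by simp [hi]))

theorem det {n : ℕ} {F G : ℝ → Matrix (Fin n) (Fin n) ℝ}
    (h : ∀ i j, CongrCube (fun q => F q i j) (fun q => G q i j)) :
    CongrCube (fun q => (F q).det) (fun q => (G q).det) := by
  simp only [Matrix.det_apply']
  exact sum _ fun σ _ => (prod _ fun i _ => h _ _).const_mul _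

theorem trans {F G H : ℝ → ℝ} (h₁ : CongrCube F G) (h₂ : CongrCube G H) : CongrCube F H := by
  obtain ⟨-, W₁, hW₁, h₁⟩ := h₁
  obtain ⟨hH, W₂, hW₂, h₂⟩ := h₂
  refine ⟨hH, _, hW₁.add hW₂, ?_⟩
  filter_upwards [h₁, h₂] with q h₁ h₂
  simp only [h₁, h₂, Pi.add_apply]
  ring

theorem tendsto {F G : ℝ → ℝ} (h : CongrCube F G) : Tendsto F (𝓝[>] 0) (𝓝 (G 0)) := by
  obtain ⟨hG, W, hW, h⟩ := h
  have hc : AnalyticAt ℝ (fun q => G q + q ^ 3 * W q) 0 := by fun_prop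
  have := hc.continuousAt.tendsto.mono_left (nhdsWithin_le_nhds (s := Set.Ioi 0))
  simp only [ne_eq, OfNat.ofNat_ne_zero, not_false_eq_true, zero_pow, zero_mul, add_zero] at this
  exact this.congr' (by filter_upwards [h] with q hq using hq.symm)

end CongrCube

/-! ### Expansions to second order -/

/-- `F` has an expansion `a + b q + c q ^ 2 + q ^ 3 W(q)` with `W` analytic. -/
def HasJet (F : ℝ → ℝ) (a b c : ℝ) : Prop := CongrCube F fun q => a + b * q + c * q ^ 2

namespace HasJet

theorem const (a : ℝ) : HasJet (fun _ => a) a 0 0 := by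
  simpa [HasJet] using CongrCube.const a

theorem add {F₁ F₂ : ℝ → ℝ} {a₁ b₁ c₁ a₂ b₂ c₂ : ℝ} (h₁ : HasJet F₁ a₁ b₁ c₁)
    (h₂ : HasJet F₂ a₂ b₂ c₂) : HasJet (fun q => F₁ q + F₂ q) (a₁ + a₂) (b₁ + b₂) (c₁ + c₂) := by
  exact (CongrCube.add h₁ h₂).congr_right fun q => by ring

theorem const_mul (k : ℝ) {F : ℝ → ℝ} {a b c : ℝ} (h : HasJet F a b c) :
    HasJet (fun q => k * F q) (k * a) (k * b) (k * c) := by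
  exact (CongrCube.const_mul k h).congr_right fun q => by ring

theorem sub {F₁ F₂ : ℝ → ℝ} {a₁ b₁ c₁ a₂ b₂ c₂ : ℝ} (h₁ : HasJet F₁ a₁ b₁ c₁)
    (h₂ : HasJet F₂ a₂ b₂ c₂) : HasJet (fun q => F₁ q - F₂ q) (a₁ - a₂) (b₁ - b₂) (c₁ - c₂) := by
  exact (CongrCube.sub h₁ h₂).congr_right fun q => by ring

theorem mul {F₁ F₂ : ℝ → ℝ} {a₁ b₁ c₁ a₂ b₂ c₂ : ℝ} (h₁ : HasJet F₁ a₁ b₁ c₁)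
    (h₂ : HasJet F₂ a₂ b₂ c₂) : HasJet (fun q => F₁ q * F₂ q)
      (a₁ * a₂) (a₁ * b₂ + b₁ * a₂) (a₁ * c₂ + b₁ * b₂ + c₁ * a₂) := by
  refine CongrCube.trans (CongrCube.mul h₁ h₂) ⟨by fun_prop, fun q => b₁ * c₂ + c₁ * b₂
    + c₁ * c₂ * q, by fun_prop, Eventually.of_forall fun q => by ring⟩

theorem inv {F : ℝ → ℝ} {b c : ℝ} (h : HasJet F 1 b c) :
    HasJet (fun q => (F q)⁻¹) 1 (-b) (b ^ 2 - c) := by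
  have hG : AnalyticAt ℝ (fun q : ℝ => 1 + b * q + c * q ^ 2) 0 := by fun_prop
  have h0 : (fun q : ℝ => 1 + b * q + c * q ^ 2) 0 ≠ 0 := by simp
  -- The cofactor comes from (1 + bq + cq^2)(1 - bq + (b^2-c)q^2) = 1 - q^3 (2bc - b^3 + (c^2 - b^2
  -- c)q).
  refine CongrCube.trans (CongrCube.inv h h0) ⟨by fun_prop,
    fun q => (2 * b * c - b ^ 3 + (c ^ 2 - b ^ 2 * c) * q) * (1 + b * q + c * q ^ 2)⁻¹,
    (by fun_prop : AnalyticAt ℝ (fun q => 2 * b * c - b ^ 3 + (c ^ 2 - b ^ 2 * c) * q) 0).mul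
      (hG.fun_inv h0), ?_⟩
  filter_upwards [(hG.continuousAt.eventually_ne h0).filter_mono nhdsWithin_le_nhds] with q hq
  have h1 := mul_inv_cancel₀ hq
  generalize (1 + b * q + c * q ^ 2)⁻¹ = y at h1 ⊢
  linear_combination (1 - b * q + (b ^ 2 - c) * q ^ 2) * h1

end HasJet

/-- Functions with an expansion to second order are sums of convergent power series. -/
theorem HasJet.exists_hasSum {F : ℝ → ℝ} {a b c : ℝ} (h : HasJet F a b c) :
    ∃ δ : ℕ → ℝ, (∃ r : ℝ, 0 < r ∧ ∀ q : ℝ, 0 < q → q < r → HasSum (fun j => δ j * q ^ j) (F q)) ∧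
      δ 0 = a ∧ δ 1 = b ∧ δ 2 = c := by
  obtain ⟨-, W, ⟨p, r, hp⟩, h⟩ := h
  have hsum := hp.eventually_hasSum
  have ev : ∀ᶠ q in 𝓝[>] (0 : ℝ), HasSum (fun j => p.coeff j * q ^ j) (W q) := by
    filter_upwards [hsum.filter_mono nhdsWithin_le_nhds] with q hq
    simpa [mul_comm] using hq
  obtain ⟨r, hr, hr'⟩ := (mem_nhdsGT_iff_exists_Ioo_subset (a := (0 : ℝ))).mp (ev.and h)
  refine ⟨fun j => match j with | 0 => a | 1 => b | 2 => c | j + 3 => p.coeff j,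
    ⟨r, hr, fun q h0 h1 => ?_⟩, rfl, rfl, rfl⟩
  obtain ⟨h2, h3⟩ := hr' ⟨h0, h1⟩
  rw [h3, ← hasSum_nat_add_iff' 3]
  have e : (fun q => a + b * q + c * q ^ 2) q + q ^ 3 * W q - ∑ i ∈ Finset.range 3,
      (match i with | 0 => a | 1 => b | 2 => c | j + 3 => p.coeff j) * q ^ i = q ^ 3 * W q := by
    simp [Finset.sum_range_succ]
  rw [e]
  convert! h2.mul_left (q ^ 3) using 2 with j
  ring

theorem HasJet.isBigO {F : ℝ → ℝ} {a b c : ℝ} (h : HasJet F a b c) :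
    (fun q => F q - (a + b * q + c * q ^ 2)) =O[𝓝[>] (0 : ℝ)] fun q => q ^ 3 := by
  obtain ⟨-, W, hW, h⟩ := h
  have h1 : (fun q : ℝ => q ^ 3 * W q) =O[𝓝[>] (0 : ℝ)] fun q => q ^ 3 * (1 : ℝ) :=
    (isBigO_refl _ _).mul
      ((hW.continuousAt.tendsto.mono_left nhdsWithin_le_nhds).isBigO_one ℝ)
  simp only [mul_one] at h1
  refine h1.congr' ?_ EventuallyEq.rfl
  filter_upwards [h] with q hq
  rw [hq]
  ring

/-! ### Orthogonal polynomials and Gram determinants -/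

open Polynomial in
theorem monicOrthogonal_eq (L : ℝ[X] → ℝ) (n : ℕ) :
    monicOrthogonal L n = X ^ n - ∑ k : Fin n,
      C (L (X ^ n * monicOrthogonal L k) / L (monicOrthogonal L k ^ 2)) * monicOrthogonal L k := by
  rw [monicOrthogonal]

open Polynomial in
theorem degree_X_pow_sub_monicOrthogonal_lt (L : ℝ[X] → ℝ) (n : ℕ) :
    (X ^ n - monicOrthogonal L n).degree < (n : WithBot ℕ) := by
  induction n using Nat.strong_induction_on with
  | _ n ih =>
    rw [monicOrthogonal_eq, sub_sub_cancel]
    refine (degree_sum_le _ _).trans_lt ((Finset.sup_lt_iff (by exact_mod_cast bot_lt_iff_ne_bot.mpr (by simp))).mpr ?_)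
    intro k _
    have hk : (monicOrthogonal L k).degree ≤ ((k : ℕ) : WithBot ℕ) := by
      have h1 := ih k k.2
      have : monicOrthogonal L k = X ^ (k : ℕ) - (X ^ (k : ℕ) - monicOrthogonal L k) := by ring
      rw [this]
      refine (degree_sub_le _ _).trans (max_le (degree_X_pow_le _) h1.le)
    rw [← smul_eq_C_mul]
    exact (degree_smul_le _ _).trans_lt (hk.trans_lt (by exact_mod_cast k.2))

open Polynomial in
theorem monic_monicOrthogonal (L : ℝ[X] → ℝ) (n : ℕ) : (monicOrthogonal L n).Monic := by
  have h := (monic_X_pow n).sub_of_left (q := X ^ n - monicOrthogonal L n) (p := (X : ℝ[X]) ^ n)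
    (by rw [degree_X_pow]; exact degree_X_pow_sub_monicOrthogonal_lt L n)
  rwa [sub_sub_cancel] at h

open Polynomial in
theorem natDegree_monicOrthogonal (L : ℝ[X] → ℝ) (n : ℕ) :
    (monicOrthogonal L n).natDegree = n := by
  have h := degree_sub_eq_left_of_degree_lt (q := X ^ n - monicOrthogonal L n) (p := (X : ℝ[X]) ^ n)
    (by rw [degree_X_pow]; exact degree_X_pow_sub_monicOrthogonal_lt L n)
  rw [sub_sub_cancel, degree_X_pow] at h
  exact natDegree_eq_of_degree_eq_some h

open Polynomial in
-- No positivity of `L` is assumed: Gram–Schmidt only needs the norms it divides by to be nonzero.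
theorem monicOrthogonal_orthogonal (L : ℝ[X] →ₗ[ℝ] ℝ) {n : ℕ}
    (h : ∀ k < n, L (monicOrthogonal L k ^ 2) ≠ 0) {m : ℕ} (hm : m ≤ n) {j : ℕ} (hj : j < m) :
    L (monicOrthogonal L m * monicOrthogonal L j) = 0 := by
  induction m using Nat.strong_induction_on generalizing j with
  | _ m ih =>
    have key : ∀ k : Fin m, k ≠ ⟨j, hj⟩ →
        L (monicOrthogonal L k * monicOrthogonal L j) = 0 := by
      intro k hk
      have hk' : (k : ℕ) ≠ j := fun h => hk (Fin.ext h)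
      rcases lt_or_gt_of_ne hk' with h1 | h1
      · rw [mul_comm]
        exact ih j hj (by omega) h1
      · exact ih k k.2 (by omega) h1
    rw [monicOrthogonal_eq, sub_mul, Finset.sum_mul, map_sub, map_sum,
      Finset.sum_eq_single ⟨j, hj⟩]
    · rw [mul_assoc, ← pow_two, ← smul_eq_C_mul, map_smul, smul_eq_mul,
        div_mul_cancel₀ _ (h j (by omega)), sub_self]
    · intro k _ hk
      rw [mul_assoc, ← smul_eq_C_mul, map_smul, key k hk, smul_zero]
    · simp

open Polynomial in
theorem map_mul_monicOrthogonal_of_degree_lt (L : ℝ[X] →ₗ[ℝ] ℝ) {m : ℕ}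
    (h : ∀ k < m, L (monicOrthogonal L k ^ 2) ≠ 0) {d : ℕ} (hd : d ≤ m) {f : ℝ[X]}
    (hf : f.degree < (d : WithBot ℕ)) : L (f * monicOrthogonal L m) = 0 := by
  induction d generalizing f with
  | zero =>
    have : f = 0 := by simpa using hf
    simp [this]
  | succ d ih =>
    have h1 : (f - C (f.coeff d) * monicOrthogonal L d).degree < (d : WithBot ℕ) := by
      rw [degree_lt_iff_coeff_zero] at hf ⊢
      intro k hk
      rcases hk.eq_or_lt with rfl | hk
      · have := monic_monicOrthogonal L d
        rw [Monic, leadingCoeff, natDegree_monicOrthogonal] at this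
        simp [this]
      · rw [coeff_sub, coeff_C_mul, hf k hk, coeff_eq_zero_of_natDegree_lt (n := k)]
        · simp
        · rwa [natDegree_monicOrthogonal]
    have h2 := ih (by omega) h1
    rw [sub_mul, map_sub, mul_assoc, ← smul_eq_C_mul, map_smul, mul_comm (monicOrthogonal L d),
      monicOrthogonal_orthogonal L h le_rfl (by omega), smul_zero, sub_zero] at h2
    exact h2

/-- The Gram determinant of the first `n` members of a sequence of polynomials. -/
noncomputable def gramDet (L : Polynomial ℝ → ℝ) (b : ℕ → Polynomial ℝ) (n : ℕ) : ℝ :=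
  (Matrix.of fun i j : Fin n => L (b i * b j)).det

open Polynomial in
-- The change of basis from the powers of X is unitriangular, so it has determinant 1.
theorem gramDet_eq_hankel (L : ℝ[X] →ₗ[ℝ] ℝ) {b : ℕ → ℝ[X]} (hm : ∀ i, (b i).Monic)
    (hd : ∀ i, (b i).natDegree = i) (n : ℕ) :
    gramDet L b n = gramDet L (fun i => X ^ i) n := by
  set T : Matrix (Fin n) (Fin n) ℝ := Matrix.of fun i j => (b j).coeff i with hT
  have hdet : T.det = 1 :=
    Matrix.det_matrixOfPolynomials (fun i : Fin n => b i) (fun i => hd i) (fun i => hm i)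
  have hb : ∀ j : Fin n, b j = ∑ k : Fin n, (b j).coeff k • (X : ℝ[X]) ^ (k : ℕ) := by
    intro j
    have h1 := (b j).as_sum_range' n (by rw [hd]; exact j.2)
    rw [Finset.sum_range fun k => monomial k ((b j).coeff k)] at h1
    simpa only [← C_mul_X_pow_eq_monomial, smul_eq_C_mul] using h1
  have hmul : (Matrix.of fun i j : Fin n => L (b i * b j))
      = T.transpose * (Matrix.of fun i j : Fin n => L (X ^ (i : ℕ) * X ^ (j : ℕ))) * T := by
    ext i j
    rw [Matrix.of_apply]
    conv_lhs => rw [hb i, hb j]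
    simp only [Matrix.mul_apply, Finset.sum_mul, Finset.mul_sum, map_sum, hT,
      Matrix.transpose_apply, Matrix.of_apply, smul_mul_assoc, mul_smul_comm, map_smul, smul_eq_mul]
    exact Finset.sum_congr rfl fun k _ => Finset.sum_congr rfl fun l _ => by ring
  rw [gramDet, gramDet, hmul, Matrix.det_mul, Matrix.det_mul, Matrix.det_transpose, hdet]
  ring

open Polynomial in
-- The last norm is never divided by, hence the condition k + 1 < n. This slack lets
-- `norm_monicOrthogonal_pos` establish positivity one norm at a time.
theorem gramDet_eq_prod (L : ℝ[X] →ₗ[ℝ] ℝ) {b : ℕ → ℝ[X]} (hm : ∀ i, (b i).Monic)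
    (hd : ∀ i, (b i).natDegree = i) {n : ℕ} (h : ∀ k, k + 1 < n → L (monicOrthogonal L k ^ 2) ≠ 0) :
    gramDet L b n = ∏ k ∈ Finset.range n, L (monicOrthogonal L k ^ 2) := by
  rw [gramDet_eq_hankel L hm hd, ← gramDet_eq_hankel L (monic_monicOrthogonal L)
    (natDegree_monicOrthogonal L), gramDet]
  have : (Matrix.of fun i j : Fin n => L (monicOrthogonal L i * monicOrthogonal L j))
      = Matrix.diagonal fun i : Fin n => L (monicOrthogonal L i ^ 2) := by
    ext i j
    rw [Matrix.of_apply]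
    have hh : ∀ k < n - 1, L (monicOrthogonal L k ^ 2) ≠ 0 := fun k hk => h k (by omega)
    rcases lt_trichotomy i j with hij | rfl | hij
    · rw [Matrix.diagonal_apply_ne _ hij.ne, mul_comm]
      exact monicOrthogonal_orthogonal L hh (by omega) hij
    · rw [Matrix.diagonal_apply_eq, pow_two]
    · rw [Matrix.diagonal_apply_ne _ hij.ne']
      exact monicOrthogonal_orthogonal L hh (by omega) hij
  rw [this, Matrix.det_diagonal, Finset.prod_range]

open Polynomial in
theorem norm_monicOrthogonal_pos (L : ℝ[X] →ₗ[ℝ] ℝ) {b : ℕ → ℝ[X]} (hm : ∀ i, (b i).Monic)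
    (hd : ∀ i, (b i).natDegree = i) {n : ℕ} (hD : ∀ k ≤ n, 0 < gramDet L b k) {k : ℕ}
    (hk : k < n) : 0 < L (monicOrthogonal L k ^ 2) := by
  induction k using Nat.strong_induction_on with
  | _ k ih =>
    have h1 := gramDet_eq_prod L hm hd (n := k + 1)
      fun j hj => (ih j (by omega) (by omega)).ne'
    have h2 := hD (k + 1) (by omega)
    rw [h1, Finset.prod_range_succ] at h2
    refine (pos_iff_pos_of_mul_pos h2).mp (Finset.prod_pos fun j hj => ?_)
    rw [Finset.mem_range] at hj
    exact ih j hj (by omega)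

open Polynomial in
/-- The squares of the Jacobi coefficients as ratios of Gram determinants. -/
theorem jacobiCoeff_sq (L : ℝ[X] →ₗ[ℝ] ℝ) {b : ℕ → ℝ[X]} (hm : ∀ i, (b i).Monic)
    (hd : ∀ i, (b i).natDegree = i) {n : ℕ} (hD : ∀ k ≤ n + 2, 0 < gramDet L b k) :
    jacobiCoeff L n ^ 2 = gramDet L b (n + 2) * gramDet L b n / gramDet L b (n + 1) ^ 2 := by
  have hpos : ∀ k < n + 2, 0 < L (monicOrthogonal L k ^ 2) :=
    fun k hk => norm_monicOrthogonal_pos L hm hd hD hk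
  have hprod : ∀ k ≤ n + 2,
      gramDet L b k = ∏ j ∈ Finset.range k, L (monicOrthogonal L j ^ 2) :=
    fun k hk => gramDet_eq_prod L hm hd fun j hj => (hpos j (by omega)).ne'
  set h₀ := L (monicOrthogonal L n ^ 2) with hh₀
  set h₁ := L (monicOrthogonal L (n + 1) ^ 2) with hh₁
  have p₀ : 0 < h₀ := hpos n (by omega)
  have p₁ : 0 < h₁ := hpos (n + 1) (by omega)
  -- X times the n-th monic polynomial differs from the next one by terms of degree at most n, which
  -- are orthogonal to the latter.
  have hX : L (X * monicOrthogonal L n * monicOrthogonal L (n + 1)) = h₁ := by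
    have hdeg : (X * monicOrthogonal L n - monicOrthogonal L (n + 1)).degree < ((n + 1 : ℕ) : WithBot ℕ) := by
      have hm0 := monic_monicOrthogonal L n
      have hm1 := monic_monicOrthogonal L (n + 1)
      have e0 : (X * monicOrthogonal L n).degree = ((n + 1 : ℕ) : WithBot ℕ) := by
        rw [degree_mul, degree_X, degree_eq_natDegree hm0.ne_zero, natDegree_monicOrthogonal]
        push_cast
        ring
      have e1 : (monicOrthogonal L (n + 1)).degree = ((n + 1 : ℕ) : WithBot ℕ) := by
        rw [degree_eq_natDegree hm1.ne_zero, natDegree_monicOrthogonal]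
      have := degree_sub_lt_left (e0.trans e1.symm) (monic_X.mul hm0).ne_zero
        ((monic_X.mul hm0).leadingCoeff.trans hm1.leadingCoeff.symm)
      rwa [e0] at this
    have h2 := map_mul_monicOrthogonal_of_degree_lt L (m := n + 1)
      (fun k hk => (hpos k (by omega)).ne') le_rfl hdeg
    rw [sub_mul, map_sub, ← pow_two] at h2
    linarith
  have ha : jacobiCoeff L n = 1 / √h₀ * (1 / √h₁) * h₁ := by
    rw [jacobiCoeff, orthonormalPoly, orthonormalPoly, ← hh₀, ← hh₁, ← hX,
      ← smul_eq_mul (1 / √_ * _), ← map_smul, smul_eq_C_mul, C_mul]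
    congr 1
    ring
  rw [hprod _ le_rfl, hprod (n + 1) (by omega), hprod n (by omega), Finset.prod_range_succ,
    Finset.prod_range_succ, ← hh₀, ← hh₁, ha]
  have hP : 0 < ∏ j ∈ Finset.range n, L (monicOrthogonal L j ^ 2) :=
    Finset.prod_pos fun j hj => hpos j (by rw [Finset.mem_range] at hj; omega)
  rw [mul_pow, mul_pow, div_pow, div_pow, Real.sq_sqrt p₀.le, Real.sq_sqrt p₁.le]
  field_simp

/-! ### The archimedean functional and its orthogonal polynomials -/

open Polynomial in
/-- The operator `f ↦ (1 + X²) f' + X f / 2`, the form that `-i d/dx` takes on multiples of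
`1 / √(e^{-x} + e^x)`, in the variable `i tanh x`. -/
noncomputable def theta : Module.End ℝ ℝ[X] :=
  LinearMap.mulLeft ℝ (1 + X ^ 2) ∘ₗ derivative + LinearMap.mulLeft ℝ (C (1 / 2) * X)

open Polynomial in
theorem theta_apply (f : ℝ[X]) : theta f = (1 + X ^ 2) * derivative f + C (1 / 2) * X * f := rfl

open Polynomial in
/-- The functional whose moments come from `1 / √(e^{-x} + e^x)` alone. -/
noncomputable def baseFunctional : ℝ[X] →ₗ[ℝ] ℝ :=
  (1 / √2) • (leval 0 ∘ₗ LinearMap.applyₗ (1 : ℝ[X]) ∘ₗ (aeval theta).toLinearMap)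

open Polynomial in
theorem baseFunctional_apply (f : ℝ[X]) :
    baseFunctional f = 1 / √2 * (aeval theta f (1 : ℝ[X])).eval 0 := rfl

open Polynomial in
-- At n = 0 the truncated exponent is harmless, as its coefficient vanishes.
theorem theta_X_pow (n : ℕ) :
    theta (X ^ n) = (n + 1 / 2 : ℝ) • X ^ (n + 1) + (n : ℝ) • X ^ (n - 1) := by
  rw [theta_apply, derivative_X_pow, smul_eq_C_mul, smul_eq_C_mul]
  rcases n with _ | n
  · simp
  · simp only [Nat.add_sub_cancel, C_add]
    push_cast
    ring

open Polynomial in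
-- Each application of θ lowers the order of vanishing at 0 by at most one. A constant term needs n
-- lowering steps, whose coefficients multiply to n!.
theorem eval_theta_pow {d n : ℕ} (h : d ≤ n) :
    ((theta ^ d) (X ^ n)).eval 0 = if d = n then (n.factorial : ℝ) else 0 := by
  induction d generalizing n with
  | zero =>
    rcases n with _ | n <;> simp
  | succ d ih =>
    obtain ⟨m, rfl⟩ : ∃ m, n = m + 1 := ⟨n - 1, by omega⟩
    rw [pow_succ, Module.End.mul_apply, theta_X_pow, map_add, map_smul, map_smul, eval_add,
      eval_smul, eval_smul, ih (by omega), Nat.add_sub_cancel, ih (by omega), if_neg (by omega)]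
    by_cases hd : d = m
    · simp [hd, Nat.factorial_succ]
    · simp [hd]

open Polynomial in
theorem eval_aeval_theta {f : ℝ[X]} (hf : f.Monic) {n : ℕ} (h : f.natDegree ≤ n) :
    (aeval theta f (X ^ n : ℝ[X])).eval 0 = if f.natDegree = n then (n.factorial : ℝ) else 0 := by
  rw [aeval_eq_sum_range, LinearMap.sum_apply, eval_finsetSum, Finset.sum_range_succ,
    Finset.sum_eq_zero, zero_add, LinearMap.smul_apply, eval_smul, eval_theta_pow h,
    hf.coeff_natDegree, one_smul]
  intro i hi
  rw [Finset.mem_range] at hi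
  rw [LinearMap.smul_apply, eval_smul, eval_theta_pow (by omega), if_neg (by omega), smul_zero]

/-- The monic orthogonal polynomials of `baseFunctional`, by their three-term recurrence. -/
noncomputable def basePoly : ℕ → Polynomial ℝ
  | 0 => 1
  | 1 => Polynomial.X
  | n + 2 => Polynomial.X * basePoly (n + 1)
      - Polynomial.C (((n : ℝ) + 1) * (n + 1 / 2)) * basePoly n

open Polynomial in
theorem basePoly_add_two (n : ℕ) : basePoly (n + 2) =
    X * basePoly (n + 1) - C (((n : ℝ) + 1) * (n + 1 / 2)) * basePoly n := rfl

open Polynomial in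
theorem basePoly_monic_and_natDegree (n : ℕ) :
    (basePoly n).Monic ∧ (basePoly n).natDegree = n := by
  induction n using Nat.strong_induction_on with
  | _ n ih =>
    match n with
    | 0 => exact ⟨monic_one, natDegree_one⟩
    | 1 => exact ⟨monic_X, natDegree_X⟩
    | n + 2 =>
      obtain ⟨h1, h2⟩ := ih (n + 1) (by omega)
      obtain ⟨h3, h4⟩ := ih n (by omega)
      have h5 : (X * basePoly (n + 1)).natDegree = n + 2 := by
        rw [natDegree_X_mul h1.ne_zero, h2]
      have h6 : (C (((n : ℝ) + 1) * (n + 1 / 2)) * basePoly n).natDegree < n + 2 :=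
        (natDegree_C_mul_le _ _).trans_lt (by omega)
      rw [← h5] at h6
      rw [basePoly_add_two]
      exact ⟨(monic_X.mul h1).sub_of_left (degree_lt_degree h6),
        (natDegree_sub_eq_left_of_natDegree_lt h6).trans h5⟩

theorem basePoly_monic (n : ℕ) : (basePoly n).Monic := (basePoly_monic_and_natDegree n).1

theorem natDegree_basePoly (n : ℕ) : (basePoly n).natDegree = n :=
  (basePoly_monic_and_natDegree n).2

theorem factorial_mul_abs_alpha_succ (n : ℕ) :
    ((n + 1).factorial : ℝ) * |alpha (n + 1)| = (n + 1 / 2) * (n.factorial * |alpha n|) := by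
  rw [abs_alpha_succ, Nat.factorial_succ]
  have hn : (n : ℝ) + 1 ≠ 0 := by positivity
  push_cast
  field_simp

open Polynomial in
-- The recurrence of `basePoly` is the one whose last term cancels the lowering part of θ at every
-- stage, leaving a single monomial.
theorem aeval_theta_basePoly (n : ℕ) :
    aeval theta (basePoly n) (1 : ℝ[X]) = ((n.factorial : ℝ) * |alpha n|) • X ^ n := by
  induction n using Nat.strong_induction_on with
  | _ n ih =>
    match n with
    | 0 => simp [basePoly, alpha_zero]
    | 1 =>
      have := theta_X_pow 0
      simp only [pow_zero] at this
      simp [basePoly, this, abs_alpha_succ 0, alpha_zero]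
    | n + 2 =>
      rw [basePoly_add_two, map_sub, map_mul, map_mul, aeval_X, aeval_C, LinearMap.sub_apply,
        Module.End.mul_apply, Module.End.mul_apply, ih (n + 1) (by omega), ih n (by omega),
        map_smul, theta_X_pow, Module.algebraMap_end_apply, factorial_mul_abs_alpha_succ (n + 1),
        factorial_mul_abs_alpha_succ n, Nat.add_sub_cancel]
      simp only [smul_eq_C_mul, C_mul, C_add]
      push_cast
      simp only [C_add]
      ring

open Polynomial in
-- The polynomial b_j(θ)1 is a multiple of X^j, from which b_i(θ) with i ≤ j can reach a constant
-- term only if i = j.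
theorem baseFunctional_basePoly_mul {i j : ℕ} (h : i ≤ j) :
    baseFunctional (basePoly i * basePoly j)
      = if i = j then (j.factorial : ℝ) ^ 2 * |alpha j| / √2 else 0 := by
  rw [baseFunctional_apply, map_mul, Module.End.mul_apply, aeval_theta_basePoly, map_smul, eval_smul,
    eval_aeval_theta (basePoly_monic i) (by rwa [natDegree_basePoly]), natDegree_basePoly]
  split_ifs
  · rw [smul_eq_mul]
    ring
  · simp

theorem baseFunctional_basePoly (i j : ℕ) :
    baseFunctional (basePoly i * basePoly j)
      = if i = j then (j.factorial : ℝ) ^ 2 * |alpha j| / √2 else 0 := by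
  rcases le_total i j with h | h
  · exact baseFunctional_basePoly_mul h
  · rw [mul_comm, baseFunctional_basePoly_mul h]
    by_cases hij : i = j
    · simp [hij]
    · simp [hij, Ne.symm hij]

open Polynomial in
-- For w = ±i these are the values at the two dominant point masses. Writing -1 as w^2 makes both
-- terms of the recurrence add up to the factor n + 3/2.
theorem aeval_basePoly {w : ℂ} (hw : w ^ 2 = -1) (n : ℕ) :
    aeval (w / 2) (basePoly n) = w ^ n * ((n.factorial * |alpha n| : ℝ) : ℂ) := by
  induction n using Nat.strong_induction_on with
  | _ n ih =>
    match n with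
    | 0 => simp [basePoly, alpha_zero]
    | 1 =>
      simp [basePoly, abs_alpha_succ 0, alpha_zero]
      ring
    | n + 2 =>
      rw [basePoly_add_two, map_sub, map_mul, map_mul, aeval_X, aeval_C, ih (n + 1) (by omega),
        ih n (by omega), factorial_mul_abs_alpha_succ (n + 1), factorial_mul_abs_alpha_succ n]
      simp only [Complex.coe_algebraMap]
      push_cast
      linear_combination (-(w ^ n * (n + 1) * ((n + 1 / 2) * (n.factorial * (|alpha n| : ℝ))))) * hw

/-! ### Its moments -/

/-- The function `1 / √(e^{-x} + e^x)`. -/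
noncomputable def baseGenerating (x : ℝ) : ℝ := 1 / √(Real.exp (-x) + Real.exp x)

theorem hasDerivAt_baseGenerating (x : ℝ) :
    HasDerivAt baseGenerating (-(1 / 2) * Real.tanh x * baseGenerating x) x := by
  have hpos : 0 < Real.exp (-x) + Real.exp x := by positivity
  have h1 : HasDerivAt (fun x => Real.exp (-x) + Real.exp x) (-Real.exp (-x) + Real.exp x) x := by
    have := ((hasDerivAt_id x).neg.exp).add (Real.hasDerivAt_exp x)
    simp only [mul_neg, mul_one] at this
    exact this
  have h2 := (h1.sqrt hpos.ne').inv (by positivity)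
  have e : baseGenerating = (fun y => √(Real.exp (-y) + Real.exp y))⁻¹ := by
    ext y
    simp [baseGenerating]
  rw [← e] at h2
  refine h2.congr_deriv ?_
  rw [baseGenerating]
  rw [Real.tanh_eq_sinh_div_cosh, Real.sinh_eq, Real.cosh_eq, Real.sq_sqrt hpos.le]
  have : Real.exp x + Real.exp (-x) ≠ 0 := by positivity
  have h3 : √(Real.exp (-x) + Real.exp x) ≠ 0 := by positivity
  field_simp
  ring

open Polynomial in
-- With t = i tanh x one has t' = i(1 + t^2), and `baseGenerating` has logarithmic derivative it/2.
-- Hence d/dx acts as iθ.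
theorem hasDerivAt_aeval_tanh (f : ℝ[X]) (x : ℝ) :
    HasDerivAt (fun x : ℝ => aeval (Complex.I * (Real.tanh x : ℝ)) f * (baseGenerating x : ℂ))
      (Complex.I * (aeval (Complex.I * (Real.tanh x : ℝ)) (theta f) * (baseGenerating x : ℂ))) x := by
  have ht : HasDerivAt Real.tanh (1 - Real.tanh x ^ 2) x := by
    have h := (Real.hasDerivAt_sinh x).div (Real.hasDerivAt_cosh x) (Real.cosh_pos x).ne'
    have e : Real.tanh = Real.sinh / Real.cosh := by
      ext y
      exact Real.tanh_eq_sinh_div_cosh y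
    rw [← e] at h
    refine h.congr_deriv ?_
    rw [e, Pi.div_apply]
    have := (Real.cosh_pos x).ne'
    field_simp
  have h1 : HasDerivAt (fun x : ℝ => Complex.I * ((Real.tanh x : ℝ) : ℂ))
      (Complex.I * ((1 - Real.tanh x ^ 2 : ℝ) : ℂ)) x := ht.ofReal_comp.const_mul _
  have h2 := (f.hasDerivAt_aeval (Complex.I * (Real.tanh x : ℝ))).comp x h1
  have h3 := h2.mul (hasDerivAt_baseGenerating x).ofReal_comp
  convert! h3 using 1
  simp only [theta_apply, map_add, map_mul, map_pow, map_one, aeval_X, aeval_C,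
    Complex.coe_algebraMap, Function.comp_apply]
  push_cast
  linear_combination (Complex.I * Complex.tanh x ^ 2 *
    aeval (Complex.I * Complex.tanh x) (derivative f) * baseGenerating x + 1 / 2 * Complex.tanh x *
    aeval (Complex.I * Complex.tanh x) f * baseGenerating x) * Complex.I_sq

/-- Allows real iterated derivatives to be computed from formulas with complex polynomial values. -/
theorem hasDerivAt_of_ofReal_eq {G : ℝ → ℝ} {Φ : ℝ → ℂ} {v : ℂ} {x : ℝ} (h : ∀ y, (G y : ℂ) = Φ y)
    (hΦ : HasDerivAt Φ v x) : ((deriv G x : ℝ) : ℂ) = v := by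
  have h1 : HasDerivAt G v.re x := by
    have := Complex.reCLM.hasFDerivAt.comp_hasDerivAt x hΦ
    have e : (Complex.reCLM ∘ Φ) = G := by
      ext y
      simp [← h]
    rwa [e] at this
  have h2 : HasDerivAt Φ ((v.re : ℝ) : ℂ) x := by
    have := h1.ofReal_comp
    simpa only [h] using this
  rw [h1.deriv]
  exact h2.unique hΦ

open Polynomial in
theorem iteratedDeriv_baseGenerating (j : ℕ) (x : ℝ) :
    ((iteratedDeriv j baseGenerating x : ℝ) : ℂ) = Complex.I ^ j *
      (aeval (Complex.I * (Real.tanh x : ℝ)) ((theta ^ j) 1) * (baseGenerating x : ℂ)) := by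
  induction j generalizing x with
  | zero => simp
  | succ j ih =>
    rw [iteratedDeriv_succ, pow_succ', pow_succ' theta, Module.End.mul_apply]
    refine hasDerivAt_of_ofReal_eq ih
      (((hasDerivAt_aeval_tanh ((theta ^ j) 1) x).const_mul (Complex.I ^ j)).congr_deriv ?_)
    ring

open Polynomial in
theorem iteratedDeriv_baseGenerating_zero (j : ℕ) :
    ((iteratedDeriv j baseGenerating 0 : ℝ) : ℂ) = Complex.I ^ j * (baseFunctional (X ^ j) : ℝ) := by
  rw [iteratedDeriv_baseGenerating, baseFunctional_apply]
  have : baseGenerating 0 = 1 / √2 := by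
    norm_num [baseGenerating]
  rw [this, map_pow, aeval_X, Real.tanh_zero, Complex.ofReal_zero, mul_zero]
  have h : (aeval (0 : ℂ)) ((theta ^ j) 1) = ((((theta ^ j) (1 : ℝ[X])).eval 0 : ℝ) : ℂ) := by
    have := aeval_algebraMap_apply ℂ (0 : ℝ) ((theta ^ j) 1)
    simpa using this
  rw [h]
  push_cast
  ring

open Polynomial in
/-- The moments of `baseFunctional`. -/
theorem baseFunctional_X_pow (j : ℕ) : baseFunctional (X ^ j) =
    if Even j then (-1) ^ (j / 2) * iteratedDeriv j baseGenerating 0 else 0 := by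
  have h := iteratedDeriv_baseGenerating_zero j
  split_ifs with hj
  · obtain ⟨k, rfl⟩ := hj
    rw [← two_mul] at h ⊢
    rw [pow_mul, Complex.I_sq] at h
    rw [Nat.mul_div_cancel_left k (by norm_num)]
    have h' : iteratedDeriv (2 * k) baseGenerating 0 = (-1) ^ k * baseFunctional (X ^ (2 * k)) := by
      exact_mod_cast h
    rw [h', ← mul_assoc, ← mul_pow]
    simp
  · obtain ⟨k, rfl⟩ := Nat.not_even_iff_odd.mp hj
    rw [pow_succ, pow_mul, Complex.I_sq] at h
    -- In odd order a real number equals an imaginary one, so both vanish.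
    have h1 := congrArg Complex.im h
    rw [show ((-1 : ℂ) ^ k * Complex.I * (baseFunctional (X ^ (2 * k + 1)) : ℝ))
      = (((-1 : ℝ) ^ k * baseFunctional (X ^ (2 * k + 1)) : ℝ) : ℂ) * Complex.I by
        push_cast; ring] at h1
    simp only [Complex.ofReal_im, Complex.mul_I_im, Complex.ofReal_re] at h1
    have : (-1 : ℝ) ^ k ≠ 0 := by positivity
    simpa using h1.symm

/-! ### Expansion of the moments in `q` -/

/-- The coefficient of `e^{-(2k + 1/2) x}` in `Σ_p(x)`, where `p = 1 / q`. -/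
noncomputable def expCoeff (q : ℝ) (k : ℕ) : ℝ := alpha k * (q ^ (2 * k + 1) / (1 - q ^ (2 * k + 1)))

/-- For |x| ≤ 1 the binomial series are taken at arguments at most q^2 e^2, so this gives their
convergence for every m. -/
theorem sq_mul_exp_two_lt_one {q : ℝ} (h0 : 0 < q) (h1 : q < 1 / 10) : q ^ 2 * Real.exp 2 < 1 := by
  have h2 : Real.exp 2 < 9 := by
    have h := Real.exp_one_lt_d9
    have e : Real.exp 2 = Real.exp 1 ^ 2 := by rw [← Real.exp_nat_mul]; norm_num
    rw [e]
    nlinarith [Real.exp_pos 1]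
  have h3 : q ^ 2 < 1 / 100 := by nlinarith
  nlinarith [Real.exp_pos 2, sq_nonneg q]

theorem exp_mul_le {x : ℝ} (hx : |x| ≤ 1) (k : ℕ) (s : ℝ) (hs : |s| = 1) :
    Real.exp (s * ((2 * k + 1 / 2) * x)) ≤ Real.exp (1 / 2) * Real.exp 2 ^ k := by
  rw [← Real.exp_nat_mul, ← Real.exp_add, Real.exp_le_exp]
  have h1 : s * ((2 * k + 1 / 2) * x) ≤ |s * ((2 * k + 1 / 2) * x)| := le_abs_self _
  have hk : (0 : ℝ) ≤ 2 * k + 1 / 2 := by positivity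
  rw [abs_mul, abs_mul, hs, one_mul, abs_of_nonneg hk] at h1
  nlinarith

theorem one_div_sqrt_eq {q : ℝ} (h0 : 0 < q) (x : ℝ) (m : ℕ) :
    1 / √(q⁻¹ ^ (2 * (m + 1)) * Real.exp x + Real.exp (-x))
      = q ^ (m + 1) * Real.exp (-(1 / 2 * x)) *
        (1 / √(1 + (q ^ (m + 1)) ^ 2 * Real.exp (-2 * x))) := by
  set Q := q ^ (m + 1) with hQ
  have hQ0 : 0 < Q := by positivity
  have e1 : q⁻¹ ^ (2 * (m + 1)) = (Q ^ 2)⁻¹ := by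
    rw [hQ, inv_pow, ← pow_mul, mul_comm 2]
  set y := Real.exp (-(1 / 2 * x)) with hy
  have hy0 : 0 < y := Real.exp_pos _
  have e2 : Real.exp x = (y ^ 2)⁻¹ := by
    rw [hy, ← Real.exp_nat_mul, ← Real.exp_neg]
    congr 1
    push_cast
    ring
  have e3 : Real.exp (-x) = y ^ 2 := by
    rw [hy, ← Real.exp_nat_mul]
    congr 1
    push_cast
    ring
  have e4 : Real.exp (-2 * x) = y ^ 4 := by
    rw [hy, ← Real.exp_nat_mul]
    congr 1
    push_cast
    ring
  have e5 : (Q ^ 2)⁻¹ * (y ^ 2)⁻¹ + y ^ 2 = ((Q * y)⁻¹) ^ 2 * (1 + Q ^ 2 * y ^ 4) := by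
    field_simp
  rw [e1, e2, e3, e4, e5, Real.sqrt_mul (by positivity), Real.sqrt_sq (by positivity)]
  field_simp

theorem hasSum_one_div_sqrt {q : ℝ} (h0 : 0 < q) (h1 : q < 1 / 10) {x : ℝ} (hx : |x| ≤ 1) (m : ℕ) :
    HasSum (fun k : ℕ => alpha k * (q ^ (2 * k + 1)) ^ (m + 1) * Real.exp (-1 * ((2 * k + 1 / 2) * x)))
      (1 / √(q⁻¹ ^ (2 * (m + 1)) * Real.exp x + Real.exp (-x))) := by
  have hz : |(q ^ (m + 1)) ^ 2 * Real.exp (-2 * x)| < 1 := by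
    rw [abs_of_pos (by positivity)]
    refine lt_of_le_of_lt ?_ (sq_mul_exp_two_lt_one h0 h1)
    gcongr
    · calc q ^ (m + 1) ≤ q ^ 1 := pow_le_pow_of_le_one h0.le (by linarith) (by omega)
        _ = q := pow_one q
    · linarith [(abs_le.mp hx).1]
  rw [one_div_sqrt_eq h0]
  convert! (hasSum_alpha hz).mul_left (q ^ (m + 1) * Real.exp (-(1 / 2 * x))) using 2 with k
  have e : Real.exp (-1 * ((2 * k + 1 / 2) * x)) = Real.exp (-(1 / 2 * x)) * Real.exp (-2 * x) ^ k := by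
    rw [← Real.exp_nat_mul, ← Real.exp_add]
    congr 1
    ring
  rw [e, mul_pow]
  ring

theorem summable_uncurry_term {q : ℝ} (h0 : 0 < q) (h1 : q < 1 / 10) {x : ℝ} (hx : |x| ≤ 1) :
    Summable (Function.uncurry fun (m k : ℕ) =>
      alpha k * (q ^ (2 * k + 1)) ^ (m + 1) * Real.exp (-1 * ((2 * k + 1 / 2) * x))) := by
  have hs1 : Summable fun m : ℕ => q ^ m := summable_geometric_of_lt_one h0.le (by linarith)
  have hs2 : Summable fun k : ℕ => Real.exp (1 / 2) * (q ^ 2 * Real.exp 2) ^ k :=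
    (summable_geometric_of_lt_one (by positivity) (sq_mul_exp_two_lt_one h0 h1)).mul_left _
  refine Summable.of_norm_bounded (hs1.mul_of_nonneg hs2 (fun m => by positivity)
    (fun k => by positivity)) ?_
  rintro ⟨m, k⟩
  simp only [Function.uncurry_apply_pair, norm_mul, Real.norm_eq_abs, Real.abs_exp]
  have b1 : |(q ^ (2 * k + 1)) ^ (m + 1)| ≤ q ^ m * (q ^ 2) ^ k := by
    rw [abs_of_pos (by positivity), ← pow_mul, ← pow_mul, ← pow_add]
    exact pow_le_pow_of_le_one h0.le (by linarith) (by nlinarith)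
  calc _ ≤ 1 * (q ^ m * (q ^ 2) ^ k) * (Real.exp (1 / 2) * Real.exp 2 ^ k) := by
        gcongr
        · exact abs_alpha_le_one k
        · exact exp_mul_le hx k (-1) (by simp)
    _ = _ := by rw [mul_pow]; ring

theorem primeSeries_eq {q : ℝ} (h0 : 0 < q) (h1 : q < 1 / 10) {x : ℝ} (hx : |x| ≤ 1) :
    primeSeries q⁻¹ x = ∑' k : ℕ, expCoeff q k * Real.exp (-1 * ((2 * k + 1 / 2) * x)) := by
  rw [primeSeries]
  simp only [← fun m => (hasSum_one_div_sqrt h0 h1 hx m).tsum_eq]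
  -- After the exchange the inner sum over m is geometric with ratio q^(2k+1).
  rw [← (summable_uncurry_term h0 h1 hx).tsum_comm]
  refine tsum_congr fun k => ?_
  have hr0 : 0 ≤ q ^ (2 * k + 1) := by positivity
  have hr1 : q ^ (2 * k + 1) < 1 := pow_lt_one₀ h0.le (by linarith) (by omega)
  have e : ∑' m : ℕ, (q ^ (2 * k + 1)) ^ (m + 1) = q ^ (2 * k + 1) / (1 - q ^ (2 * k + 1)) := by
    generalize q ^ (2 * k + 1) = r at hr0 hr1 ⊢
    simp only [pow_succ r]
    rw [tsum_mul_right, tsum_geometric_of_lt_one hr0 hr1, mul_comm, div_eq_mul_inv]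
  rw [tsum_mul_right, tsum_mul_left, expCoeff, e]

theorem abs_expCoeff_le {q : ℝ} (h0 : 0 < q) (h1 : q < 1 / 10) (k : ℕ) :
    |expCoeff q k| ≤ (q ^ 2) ^ k := by
  have hq : q ^ (2 * k + 1) ≤ q := by
    calc q ^ (2 * k + 1) ≤ q ^ 1 := pow_le_pow_of_le_one h0.le (by linarith) (by omega)
      _ = q := pow_one q
  have hpos : 0 < 1 - q ^ (2 * k + 1) := by linarith
  rw [expCoeff, abs_mul, abs_of_nonneg (a := q ^ (2 * k + 1) / _) (by positivity), ← pow_mul]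
  refine le_trans (mul_le_of_le_one_left (by positivity) (abs_alpha_le_one k)) ?_
  rw [div_le_iff₀ hpos, pow_succ]
  have : 0 < q ^ (2 * k) := by positivity
  rw [pow_succ] at hq
  nlinarith

/-- The base 2k+3 dominates both 2k+1/2 and 2(k+1)+1/2, the two quantities to be bounded later. -/
theorem summable_linear_pow_mul_geometric (j : ℕ) {r : ℝ} (h0 : 0 < r) (h1 : r < 1) :
    Summable fun k : ℕ => (2 * (k : ℝ) + 3) ^ j * r ^ k := by
  have h := summable_pow_mul_geometric_of_norm_lt_one j (r := r) (by rwa [Real.norm_of_nonneg h0.le])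
  have h2 := ((summable_nat_add_iff 1).mpr h).mul_left (3 ^ j * r⁻¹)
  refine Summable.of_nonneg_of_le (fun k => by positivity) (fun k => ?_) h2
  have e : 3 ^ j * r⁻¹ * (((k + 1 : ℕ) : ℝ) ^ j * r ^ (k + 1)) = (3 * ((k : ℝ) + 1)) ^ j * r ^ k := by
    rw [mul_pow]
    push_cast
    field_simp
    ring
  rw [e]
  gcongr
  linarith

/-- The `j`-th derivative of the terms of `Σ_p(x) + Σ_p(-x)`. -/
noncomputable def expTerm (q : ℝ) (j k : ℕ) (x : ℝ) : ℝ :=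
  expCoeff q k * ((-(2 * k + 1 / 2)) ^ j * Real.exp (-1 * ((2 * k + 1 / 2) * x))
    + (2 * k + 1 / 2) ^ j * Real.exp (1 * ((2 * k + 1 / 2) * x)))

theorem hasDerivAt_expTerm (q : ℝ) (j k : ℕ) (x : ℝ) :
    HasDerivAt (expTerm q j k) (expTerm q (j + 1) k x) x := by
  have h : ∀ s : ℝ, HasDerivAt (fun x : ℝ => Real.exp (s * ((2 * k + 1 / 2) * x)))
      (Real.exp (s * ((2 * k + 1 / 2) * x)) * (s * (2 * k + 1 / 2))) x := by
    intro s
    have := (((hasDerivAt_id x).const_mul (2 * (k : ℝ) + 1 / 2)).const_mul s).exp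
    simpa using this
  refine HasDerivAt.congr_deriv ((((h (-1)).const_mul _).add ((h 1).const_mul _)).const_mul _) ?_
  rw [expTerm]
  ring

/-- A Weierstrass bound uniform in |x| ≤ 1, for differentiating the series term by term. -/
theorem exists_summable_bound_expTerm {q : ℝ} (h0 : 0 < q) (h1 : q < 1 / 10) (j : ℕ) :
    ∃ u : ℕ → ℝ, Summable u ∧ ∀ k x, |x| ≤ 1 → ‖expTerm q j k x‖ ≤ u k := by
  refine ⟨_, (summable_linear_pow_mul_geometric j (r := q ^ 2 * Real.exp 2) (by positivity)
    (sq_mul_exp_two_lt_one h0 h1)).mul_left (2 * Real.exp (1 / 2)), fun k x hx => ?_⟩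
  have hk : (2 * (k : ℝ) + 1 / 2) ^ j ≤ (2 * (k : ℝ) + 3) ^ j := by gcongr; norm_num
  have hk' : |(2 * (k : ℝ) + 1 / 2)| = 2 * (k : ℝ) + 1 / 2 := abs_of_nonneg (by positivity)
  rw [expTerm, norm_mul, Real.norm_eq_abs, Real.norm_eq_abs]
  calc _ ≤ (q ^ 2) ^ k * ((2 * (k : ℝ) + 3) ^ j * (Real.exp (1 / 2) * Real.exp 2 ^ k)
        + (2 * (k : ℝ) + 3) ^ j * (Real.exp (1 / 2) * Real.exp 2 ^ k)) := by
        gcongr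
        · exact abs_expCoeff_le h0 h1 k
        · refine (abs_add_le _ _).trans ?_
          rw [abs_mul, abs_mul, Real.abs_exp, Real.abs_exp, abs_pow, abs_pow, abs_neg, hk']
          gcongr
          · exact exp_mul_le hx k (-1) (by simp)
          · exact exp_mul_le hx k 1 (by simp)
    _ = _ := by rw [mul_pow]; ring

theorem summable_expTerm {q : ℝ} (h0 : 0 < q) (h1 : q < 1 / 10) (j : ℕ) {x : ℝ} (hx : |x| ≤ 1) :
    Summable fun k => expTerm q j k x := by
  obtain ⟨u, hu, h⟩ := exists_summable_bound_expTerm h0 h1 j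
  exact Summable.of_norm_bounded hu fun k => h k x hx

theorem hasDerivAt_tsum_expTerm {q : ℝ} (h0 : 0 < q) (h1 : q < 1 / 10) (j : ℕ) {x : ℝ}
    (hx : x ∈ Metric.ball (0 : ℝ) 1) :
    HasDerivAt (fun x => ∑' k, expTerm q j k x) (∑' k, expTerm q (j + 1) k x) x := by
  obtain ⟨u, hu, h⟩ := exists_summable_bound_expTerm h0 h1 (j + 1)
  have hb : ∀ y ∈ Metric.ball (0 : ℝ) 1, |y| ≤ 1 := fun y hy => by simpa using (mem_ball_zero_iff.mp hy).le
  exact hasDerivAt_tsum_of_isPreconnected hu Metric.isOpen_ball (convex_ball _ _).isPreconnected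
    (fun k y _ => hasDerivAt_expTerm q j k y) (fun k y hy => h k y (hb y hy))
    (Metric.mem_ball_self one_pos) (summable_expTerm h0 h1 j (by simp)) hx

theorem summable_expCoeff_mul_exp {q : ℝ} (h0 : 0 < q) (h1 : q < 1 / 10) {x : ℝ} (hx : |x| ≤ 1)
    {s : ℝ} (hs : |s| = 1) :
    Summable fun k : ℕ => expCoeff q k * Real.exp (s * ((2 * k + 1 / 2) * x)) := by
  refine Summable.of_norm_bounded ((summable_geometric_of_lt_one (by positivity)
    (sq_mul_exp_two_lt_one h0 h1)).mul_left (Real.exp (1 / 2))) fun k => ?_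
  rw [norm_mul, Real.norm_eq_abs, Real.norm_eq_abs, Real.abs_exp]
  calc _ ≤ (q ^ 2) ^ k * (Real.exp (1 / 2) * Real.exp 2 ^ k) :=
        mul_le_mul (abs_expCoeff_le h0 h1 k) (exp_mul_le hx k s hs) (by positivity) (by positivity)
    _ = _ := by rw [mul_pow]; ring

theorem momentGenerating_eq {q : ℝ} (h0 : 0 < q) (h1 : q < 1 / 10) {x : ℝ} (hx : |x| ≤ 1) :
    momentGenerating q⁻¹ x = baseGenerating x + ∑' k, expTerm q 0 k x := by
  rw [momentGenerating, primeSeries_eq h0 h1 hx, primeSeries_eq h0 h1 (by rwa [abs_neg]), add_assoc,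
    ← baseGenerating]
  congr 1
  have e : ∀ k : ℕ, Real.exp (-1 * ((2 * k + 1 / 2) * -x)) = Real.exp (1 * ((2 * k + 1 / 2) * x)) := by
    intro k
    congr 1
    ring
  simp only [e]
  rw [← (summable_expCoeff_mul_exp h0 h1 hx (by simp)).tsum_add
    (summable_expCoeff_mul_exp h0 h1 hx (by simp))]
  refine tsum_congr fun k => ?_
  rw [expTerm]
  ring

theorem contDiff_baseGenerating {n : WithTop ℕ∞} : ContDiff ℝ n baseGenerating := by
  have : baseGenerating = fun x => (√(Real.exp (-x) + Real.exp x))⁻¹ := by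
    ext x
    simp [baseGenerating]
  rw [this]
  refine ContDiff.inv (ContDiff.sqrt (by fun_prop) fun x => ?_) fun x => ?_ <;> positivity

theorem iteratedDeriv_momentGenerating {q : ℝ} (h0 : 0 < q) (h1 : q < 1 / 10) (j : ℕ) {x : ℝ}
    (hx : x ∈ Metric.ball (0 : ℝ) 1) : iteratedDeriv j (momentGenerating q⁻¹) x
      = iteratedDeriv j baseGenerating x + ∑' k, expTerm q j k x := by
  induction j generalizing x with
  | zero =>
    simp only [iteratedDeriv_zero]
    exact momentGenerating_eq h0 h1 (by simpa using (mem_ball_zero_iff.mp hx).le)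
  | succ j ih =>
    have hev : iteratedDeriv j (momentGenerating q⁻¹) =ᶠ[𝓝 x]
        fun x => iteratedDeriv j baseGenerating x + ∑' k, expTerm q j k x := by
      filter_upwards [Metric.isOpen_ball.mem_nhds hx] with y hy using ih hy
    rw [iteratedDeriv_succ, hev.deriv_eq, iteratedDeriv_succ]
    have hd : DifferentiableAt ℝ (iteratedDeriv j baseGenerating) x :=
      (contDiff_baseGenerating (n := (j + 1 : ℕ))).differentiable_iteratedDeriv j
        (by exact_mod_cast Nat.lt_succ_self j) x
    exact (hd.hasDerivAt.add (hasDerivAt_tsum_expTerm h0 h1 j hx)).deriv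

/-- The moments of the sum of the point masses at `± i (2k + 1/2)`. -/
noncomputable def massMoment (k j : ℕ) : ℝ :=
  if Even j then 2 * (-1) ^ (j / 2) * (2 * k + 1 / 2) ^ j else 0

open Polynomial in
theorem moment_eq {q : ℝ} (h0 : 0 < q) (h1 : q < 1 / 10) (j : ℕ) :
    moment q⁻¹ j = baseFunctional (X ^ j) + ∑' k, expCoeff q k * massMoment k j := by
  rw [moment, baseFunctional_X_pow]
  simp only [massMoment]
  split_ifs with hj
  · rw [iteratedDeriv_momentGenerating h0 h1 j (Metric.mem_ball_self one_pos), mul_add, ← tsum_mul_left]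
    congr 1
    refine tsum_congr fun k => ?_
    rw [expTerm, hj.neg_pow]
    simp
    ring
  · simp

open Polynomial in
theorem summable_expCoeff_mul_massMoment {q : ℝ} (h0 : 0 < q) (h1 : q < 1 / 10) (j : ℕ) :
    Summable fun k => expCoeff q k * massMoment k j := by
  simp only [massMoment]
  split_ifs with hj
  · refine ((summable_expTerm h0 h1 j (x := 0) (by simp)).mul_left ((-1) ^ (j / 2))).congr fun k => ?_
    rw [expTerm, hj.neg_pow]
    simp
    ring
  · simp

/-- Passing to ℂ, a locally uniform limit of holomorphic functions is holomorphic. On |z| < 1/2 the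
denominators have modulus at least 1/2. -/
theorem analyticAt_lambert {a : ℕ → ℝ} (ha : Summable fun k => |a k| * (1 / 4) ^ k) :
    AnalyticAt ℝ (fun q : ℝ => ∑' k, a k * (q ^ (2 * k) / (1 - q ^ (2 * k + 3)))) 0 := by
  have hz : ∀ z ∈ Metric.ball (0 : ℂ) (1 / 2), ∀ k : ℕ, 1 / 2 ≤ ‖1 - z ^ (2 * k + 3)‖ := by
    intro z hz k
    have hz : ‖z‖ < 1 / 2 := by simpa using hz
    have h1 : ‖z ^ (2 * k + 3)‖ ≤ 1 / 2 := by
      rw [norm_pow]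
      calc ‖z‖ ^ (2 * k + 3) ≤ ‖z‖ ^ 1 :=
            pow_le_pow_of_le_one (norm_nonneg _) (by linarith) (by omega)
        _ ≤ 1 / 2 := by rw [pow_one]; exact hz.le
    have h2 := norm_sub_norm_le (1 : ℂ) (z ^ (2 * k + 3))
    rw [norm_one] at h2
    linarith
  have hd : DifferentiableOn ℂ
      (fun z : ℂ => ∑' k, (a k : ℂ) * (z ^ (2 * k) / (1 - z ^ (2 * k + 3)))) (Metric.ball 0 (1 / 2)) := by
    refine Complex.differentiableOn_tsum_of_summable_norm (ha.mul_left 2) (fun k => ?_)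
      Metric.isOpen_ball fun k z hz' => ?_
    · refine DifferentiableOn.const_mul (DifferentiableOn.div (by fun_prop) (by fun_prop) ?_) _
      intro z hz' h
      have := hz z hz' k
      rw [h] at this
      norm_num at this
    · have h1 := hz z hz' k
      have h2 : ‖z‖ < 1 / 2 := by simpa using hz'
      rw [norm_mul, norm_div, Complex.norm_real, norm_pow, Real.norm_eq_abs, mul_left_comm]
      refine mul_le_mul_of_nonneg_left ?_ (abs_nonneg _)
      rw [div_le_iff₀ (by linarith), pow_mul]
      have h3 : (‖z‖ ^ 2) ^ k ≤ (1 / 4) ^ k := by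
        gcongr
        nlinarith [norm_nonneg z]
      have h4 : (0 : ℝ) < (1 / 4) ^ k := by positivity
      nlinarith
  have hA := (hd.analyticAt (Metric.isOpen_ball.mem_nhds
    (Metric.mem_ball_self (by norm_num : (0 : ℝ) < 1 / 2)))).restrictScalars (𝕜 := ℝ)
  have hB : AnalyticAt ℝ (fun q : ℝ => Complex.reCLM
      ((fun z : ℂ => ∑' k, (a k : ℂ) * (z ^ (2 * k) / (1 - z ^ (2 * k + 3)))) (Complex.ofRealCLM q))) 0 := by
    exact (Complex.reCLM.analyticAt _).comp
      (hA.comp_of_eq (Complex.ofRealCLM.analyticAt 0) (map_zero Complex.ofRealCLM))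
  refine hB.congr (Eventually.of_forall fun q => ?_)
  simp only [Complex.ofRealCLM_apply, Complex.reCLM_apply]
  norm_cast

open Polynomial in
-- The pair ±i/2 has weight q/(1-q) = q + q^2 + q^3/(1-q). Every later pair carries a factor q^3.
theorem congrCube_moment (j : ℕ) : CongrCube (fun q => moment q⁻¹ j)
    (fun q => baseFunctional (X ^ j) + (q + q ^ 2) * massMoment 0 j) := by
  have hs : Summable fun k => |alpha (k + 1) * massMoment (k + 1) j| * (1 / 4) ^ k := by
    refine Summable.of_nonneg_of_le (fun k => by positivity) (fun k => ?_)
      ((summable_linear_pow_mul_geometric j (r := 1 / 4) (by norm_num) (by norm_num)).mul_left 2)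
    rw [← mul_assoc]
    refine mul_le_mul_of_nonneg_right ?_ (by positivity)
    rw [abs_mul]
    refine (mul_le_of_le_one_left (abs_nonneg _) (abs_alpha_le_one _)).trans ?_
    rw [massMoment]
    split_ifs
    · rw [abs_mul, abs_mul, abs_pow, abs_neg, abs_one, one_pow, mul_one, abs_two, abs_pow,
        abs_of_nonneg (by positivity)]
      refine mul_le_mul_of_nonneg_left (pow_le_pow_left₀ (by positivity) ?_ _) (by norm_num)
      push_cast
      linarith
    · simp; positivity
  have hW : AnalyticAt ℝ (fun q : ℝ => (1 - q)⁻¹ * massMoment 0 j) 0 :=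
    ((by fun_prop : AnalyticAt ℝ (fun q : ℝ => 1 - q) 0).fun_inv (by simp)).mul analyticAt_const
  refine ⟨by fun_prop, _, hW.add (analyticAt_lambert hs), ?_⟩
  filter_upwards [Ioo_mem_nhdsGT (by norm_num : (0 : ℝ) < 1 / 10)] with q hq
  obtain ⟨h0, h1⟩ := hq
  rw [moment_eq h0 h1, (summable_expCoeff_mul_massMoment h0 h1 j).tsum_eq_zero_add, Pi.add_apply,
    mul_add, ← tsum_mul_left (a := q ^ 3)]
  have e : ∀ k : ℕ, expCoeff q (k + 1) * massMoment (k + 1) j = q ^ 3 *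
      (alpha (k + 1) * massMoment (k + 1) j * (q ^ (2 * k) / (1 - q ^ (2 * k + 3)))) := by
    intro k
    rw [expCoeff, show 2 * (k + 1) + 1 = 2 * k + 3 by ring, pow_add q (2 * k) 3]
    ring
  simp only [e]
  rw [expCoeff, alpha_zero]
  have h2 : 1 - q ≠ 0 := by linarith
  simp only [mul_zero, zero_add, pow_one]
  field_simp
  ring

/-! ### The Gram determinants to second order -/

open Polynomial in
/-- The functional of `momentFunctional` as a linear map. -/
noncomputable def momentLinear (p : ℝ) : ℝ[X] →ₗ[ℝ] ℝ where
  toFun := momentFunctional p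
  map_add' f g := sum_add_index f g _ (by simp) (by intros; ring)
  map_smul' c f := by
    rw [momentFunctional, sum_smul_index f c _ (by simp), momentFunctional, Polynomial.sum,
      Polynomial.sum, RingHom.id_apply, smul_eq_mul, Finset.mul_sum]
    exact Finset.sum_congr rfl fun i _ => by ring

open Polynomial in
theorem coe_momentLinear (p : ℝ) : ⇑(momentLinear p) = momentFunctional p := rfl

open Polynomial in
/-- The sum of the evaluations at `i/2` and `-i/2`. -/
noncomputable def massFunctional (f : ℝ[X]) : ℝ := f.sum fun j b => b * massMoment 0 j

open Polynomial in
theorem ofReal_massFunctional (f : ℝ[X]) :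
    (massFunctional f : ℂ) = aeval (Complex.I / 2) f + aeval (-Complex.I / 2) f := by
  have h : ∀ j, (massMoment 0 j : ℂ) = (Complex.I / 2) ^ j + (-Complex.I / 2) ^ j := by
    intro j
    rw [massMoment]
    split_ifs with hj
    · obtain ⟨k, rfl⟩ := hj
      rw [← two_mul, Nat.mul_div_cancel_left k (by norm_num), pow_mul, pow_mul, pow_mul, div_pow _ _ 2,
        div_pow _ _ 2, neg_sq, Complex.I_sq, div_pow]
      push_cast
      rw [show ((2 : ℂ) * 0 + 1 / 2) ^ 2 = 1 / 2 ^ 2 by norm_num, div_pow]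
      ring
    · rw [neg_div, (Nat.not_even_iff_odd.mp hj).neg_pow]
      simp
  rw [massFunctional, aeval_eq_sum_range, aeval_eq_sum_range, ← Finset.sum_add_distrib,
    sum_over_range _ (by simp)]
  push_cast
  refine Finset.sum_congr rfl fun j _ => ?_
  rw [h, Complex.real_smul, Complex.real_smul]
  ring

open Polynomial in
theorem congrCube_momentFunctional (f : ℝ[X]) : CongrCube (fun q => momentFunctional q⁻¹ f)
    (fun q => baseFunctional f + (q + q ^ 2) * massFunctional f) := by
  have h := CongrCube.sum f.support fun j _ => (congrCube_moment j).const_mul (f.coeff j)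
  refine h.congr_right fun q => ?_
  have hb : baseFunctional f = ∑ j ∈ f.support, f.coeff j * baseFunctional (X ^ j) := by
    conv_lhs => rw [f.as_sum_support_C_mul_X_pow]
    rw [map_sum]
    exact Finset.sum_congr rfl fun j _ => by rw [← smul_eq_C_mul, map_smul, smul_eq_mul]
  rw [hb, massFunctional, Polynomial.sum, Finset.mul_sum, ← Finset.sum_add_distrib]
  exact Finset.sum_congr rfl fun j _ => by ring

/-- The norms of the polynomials `basePoly`. -/
noncomputable def baseNorm (i : ℕ) : ℝ := (i.factorial : ℝ) ^ 2 * |alpha i| / √2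

theorem baseNorm_pos (i : ℕ) : 0 < baseNorm i := by
  have := abs_pos.mpr (alpha_ne_zero i)
  rw [baseNorm]
  positivity

theorem baseNorm_succ (i : ℕ) : baseNorm (i + 1) = (i + 1) * (i + 1 / 2) * baseNorm i := by
  rw [baseNorm, baseNorm, pow_two, mul_assoc, factorial_mul_abs_alpha_succ, Nat.factorial_succ]
  push_cast
  ring

/-- The partial sums of the coefficients `α_i`. -/
noncomputable def alphaSum (n : ℕ) : ℝ := ∑ i ∈ Finset.range n, alpha i

theorem alphaSum_succ (n : ℕ) : alphaSum (n + 1) = alphaSum n + alpha n :=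
  Finset.sum_range_succ _ _

/-- The Gram determinant of the first `n` polynomials `basePoly` for the functional
`baseFunctional + ε massFunctional`. -/
theorem det_perturbed (n : ℕ) (ε : ℝ) :
    (Matrix.of fun i j : Fin n => baseFunctional (basePoly i * basePoly j)
      + ε * massFunctional (basePoly i * basePoly j)).det
      = (∏ i ∈ Finset.range n, baseNorm i) *
        ((1 + ε * (√2 * alphaSum n)) ^ 2 - (ε * (√2 * (2 * n * |alpha n|))) ^ 2) := by
  set c : ℕ → ℂ := fun i => ((i.factorial * |alpha i| : ℝ) : ℂ) with hc
  set w : Fin 2 → ℂ := ![Complex.I, -Complex.I] with hw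
  -- The columns hold the values of `basePoly` at i/2 and -i/2, so the perturbation is ε U Uᵀ,
  -- without conjugation.
  set U : Matrix (Fin n) (Fin 2) ℂ := Matrix.of fun i s => w s ^ (i : ℕ) * c i with hU
  set D : Matrix (Fin n) (Fin n) ℂ := Matrix.diagonal fun i => (baseNorm i : ℂ) with hD
  have hn0 : ∀ i, (baseNorm i : ℂ) ≠ 0 := fun i => by exact_mod_cast (baseNorm_pos i).ne'
  have hmat : (algebraMap ℝ ℂ).mapMatrix (Matrix.of fun i j : Fin n =>
      baseFunctional (basePoly i * basePoly j) + ε * massFunctional (basePoly i * basePoly j))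
      = D + U * ((ε : ℂ) • U.transpose) := by
    ext i j
    rw [RingHom.mapMatrix_apply, Matrix.map_apply, Matrix.of_apply, Matrix.add_apply,
      Matrix.mul_apply, Fin.sum_univ_two, baseFunctional_basePoly, hD, Matrix.diagonal_apply]
    simp only [Complex.coe_algebraMap, hU, Matrix.of_apply, Matrix.smul_apply,
      Matrix.transpose_apply, smul_eq_mul]
    rw [Complex.ofReal_add, Complex.ofReal_mul, ofReal_massFunctional, map_mul, map_mul,
      aeval_basePoly Complex.I_sq, aeval_basePoly Complex.I_sq, aeval_basePoly (by simp),
      aeval_basePoly (by simp)]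
    congr 1
    · by_cases hij : i = j
      · simp [hij, baseNorm]
      · simp [hij, Fin.val_inj]
    · simp only [hw, hc, Matrix.cons_val_zero, Matrix.cons_val_one]
      ring
  have hDdet : D.det = ((∏ i ∈ Finset.range n, baseNorm i : ℝ) : ℂ) := by
    rw [hD, Matrix.det_diagonal, Finset.prod_range]
    push_cast
    rfl
  have hDunit : IsUnit D.det := by
    rw [hDdet, isUnit_iff_ne_zero]
    exact_mod_cast (Finset.prod_pos fun i _ => baseNorm_pos i).ne'
  have hDinv : D⁻¹ = Matrix.diagonal fun i : Fin n => (baseNorm i : ℂ)⁻¹ := by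
    refine Matrix.inv_eq_left_inv ?_
    rw [hD, Matrix.diagonal_mul_diagonal]
    simp [hn0]
  have hentry : ∀ s t : Fin 2, ((1 + (ε : ℂ) • U.transpose * D⁻¹ * U : Matrix (Fin 2) (Fin 2) ℂ)) s t
      = (1 : Matrix (Fin 2) (Fin 2) ℂ) s t
        + ε * ∑ i : Fin n, (w s * w t) ^ (i : ℕ) * ((√2 * |alpha i| : ℝ) : ℂ) := by
    intro s t
    rw [Matrix.add_apply, hDinv, Matrix.mul_apply, Finset.mul_sum]
    congr 1
    refine Finset.sum_congr rfl fun i _ => ?_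
    rw [Matrix.mul_diagonal, Matrix.smul_apply, Matrix.transpose_apply, hU, Matrix.of_apply,
      Matrix.of_apply, smul_eq_mul]
    have e : c i * (baseNorm i : ℂ)⁻¹ * c i = ((√2 * |alpha i| : ℝ) : ℂ) := by
      have h1 : |alpha i| ≠ 0 := abs_ne_zero.mpr (alpha_ne_zero i)
      have h2 : ((i : ℕ).factorial : ℝ) ≠ 0 := by positivity
      have h3 : ((i : ℕ).factorial * |alpha i|) * (baseNorm i)⁻¹ * ((i : ℕ).factorial * |alpha i|)
          = √2 * |alpha i| := by
        rw [baseNorm]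
        field_simp
      rw [← h3, hc]
      push_cast
      ring
    rw [← e, mul_pow]
    ring
  -- On the diagonal of the 2×2 matrix the sign -1 turns |α_i| into α_i. Off the diagonal the sign
  -- is 1, which gives ∑ |α_i|.
  have hx : ∀ s, w s * w s = -1 := by
    intro s
    fin_cases s <;> simp [hw]
  have hy : w 0 * w 1 = 1 := by simp [hw]
  have hsx : ∑ i : Fin n, (-1 : ℂ) ^ (i : ℕ) * ((√2 * |alpha i| : ℝ) : ℂ)
      = ((√2 * alphaSum n : ℝ) : ℂ) := by
    rw [alphaSum, Finset.sum_range, Finset.mul_sum, Complex.ofReal_sum]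
    refine Finset.sum_congr rfl fun i _ => ?_
    nth_rewrite 2 [alpha_eq_neg_one_pow_mul]
    push_cast
    ring
  have hsy : ∑ i : Fin n, (1 : ℂ) ^ (i : ℕ) * ((√2 * |alpha i| : ℝ) : ℂ)
      = ((√2 * (2 * n * |alpha n|) : ℝ) : ℂ) := by
    rw [← sum_abs_alpha, Finset.sum_range, Finset.mul_sum, Complex.ofReal_sum]
    simp
  have hdet := congrArg Matrix.det hmat
  rw [← RingHom.map_det, Matrix.det_add_mul _ _ hDunit, Matrix.det_fin_two, hentry, hentry, hentry,
    hentry, hx, hx, mul_comm (w 1) (w 0), hy, hsx, hsy, hDdet] at hdet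
  have : ((Matrix.of fun i j : Fin n => baseFunctional (basePoly i * basePoly j)
      + ε * massFunctional (basePoly i * basePoly j)).det : ℂ)
      = (((∏ i ∈ Finset.range n, baseNorm i) *
        ((1 + ε * (√2 * alphaSum n)) ^ 2 - (ε * (√2 * (2 * n * |alpha n|))) ^ 2) : ℝ) : ℂ) := by
    refine hdet.trans ?_
    simp only [Matrix.one_apply_eq, Matrix.one_apply_ne, ne_eq, zero_ne_one, one_ne_zero,
      not_false_eq_true]
    push_cast
    ring
  exact_mod_cast this

theorem congrCube_gramDet (n : ℕ) :
    CongrCube (fun q => gramDet (momentFunctional q⁻¹) basePoly n)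
      (fun q => (∏ i ∈ Finset.range n, baseNorm i) *
        ((1 + (q + q ^ 2) * (√2 * alphaSum n)) ^ 2
          - ((q + q ^ 2) * (√2 * (2 * n * |alpha n|))) ^ 2)) := by
  refine CongrCube.congr_right (CongrCube.det (F := fun q => Matrix.of fun i j : Fin n =>
    momentFunctional q⁻¹ (basePoly i * basePoly j)) (G := fun q => Matrix.of fun i j : Fin n =>
    baseFunctional (basePoly i * basePoly j) + (q + q ^ 2) * massFunctional (basePoly i * basePoly j))
    fun i j => ?_) fun q => det_perturbed n (q + q ^ 2)
  exact congrCube_momentFunctional _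

/-- The Gram determinants, normalized to be `1` at `q = 0`. -/
noncomputable def normalizedGram (n : ℕ) (q : ℝ) : ℝ :=
  gramDet (momentFunctional q⁻¹) basePoly n / ∏ i ∈ Finset.range n, baseNorm i

theorem prod_baseNorm_pos (n : ℕ) : 0 < ∏ i ∈ Finset.range n, baseNorm i :=
  Finset.prod_pos fun i _ => baseNorm_pos i

theorem hasJet_normalizedGram (n : ℕ) : HasJet (normalizedGram n) 1 (2 * √2 * alphaSum n)
    (2 * √2 * alphaSum n + 2 * alphaSum n ^ 2 - 8 * n ^ 2 * alpha n ^ 2) := by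
  have h2 : √2 ^ 2 = (2 : ℝ) := Real.sq_sqrt (by norm_num)
  have h3 := sq_abs (alpha n)
  have h := (congrCube_gramDet n).const_mul (∏ i ∈ Finset.range n, baseNorm i)⁻¹
  have h4 := (prod_baseNorm_pos n).ne'
  -- The cofactor is the q^3 part of ε^2 = q^2 + q^3(2 + q), where ε = q + q^2.
  refine CongrCube.trans (h.congr_left (Eventually.of_forall fun q => ?_)) ⟨by fun_prop,
    fun q => (2 + q) * (2 * alphaSum n ^ 2 - 8 * n ^ 2 * alpha n ^ 2), by fun_prop,
    Eventually.of_forall fun q => ?_⟩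
  · rw [normalizedGram, div_eq_inv_mul]
  · beta_reduce
    rw [inv_mul_cancel_left₀ h4, mul_pow, mul_pow √2, h2, mul_pow _ |alpha n|, h3, ← sub_eq_zero]
    linear_combination ((q + q ^ 2) ^ 2 * alphaSum n ^ 2) * h2

theorem eventually_gramDet_pos (n : ℕ) :
    ∀ᶠ q in 𝓝[>] (0 : ℝ), 0 < gramDet (momentFunctional q⁻¹) basePoly n := by
  have h := CongrCube.tendsto (hasJet_normalizedGram n)
  have h1 := h.eventually_const_lt (u := 0) (by simp)
  filter_upwards [h1] with q hq
  rw [normalizedGram] at hq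
  exact (div_pos_iff_of_pos_right (prod_baseNorm_pos n)).mp hq

/-- The prefactor is the ratio of consecutive base norms, that is the unperturbed a(n)^2. -/
theorem eventually_jacobiCoeff_sq (n : ℕ) : ∀ᶠ q in 𝓝[>] (0 : ℝ),
    jacobiCoeff (momentFunctional q⁻¹) n ^ 2 = (n + 1) * (n + 1 / 2) *
      (normalizedGram (n + 2) q * normalizedGram n q
        * (normalizedGram (n + 1) q * normalizedGram (n + 1) q)⁻¹) := by
  have h : ∀ᶠ q in 𝓝[>] (0 : ℝ), ∀ k ∈ Finset.range (n + 3),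
      0 < gramDet (momentFunctional q⁻¹) basePoly k :=
    (Filter.eventually_all_finset _).mpr fun k _ => eventually_gramDet_pos k
  filter_upwards [h] with q hq
  have hD : ∀ k ≤ n + 2, 0 < gramDet (momentLinear q⁻¹) basePoly k := fun k hk =>
    hq k (by rw [Finset.mem_range]; omega)
  have := jacobiCoeff_sq (momentLinear q⁻¹) basePoly_monic natDegree_basePoly hD
  rw [coe_momentLinear] at this hD
  rw [this]
  have h0 := prod_baseNorm_pos n
  have h1 := baseNorm_pos n
  have h2 := hD (n + 1) (by omega)
  simp only [normalizedGram, Finset.prod_range_succ, baseNorm_succ]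
  generalize (∏ i ∈ Finset.range n, baseNorm i) = P at h0
  have h3 : (0 : ℝ) < n + 1 := by positivity
  have h4 : (0 : ℝ) < n + 1 / 2 := by positivity
  generalize (n : ℝ) + 1 = u at h3
  generalize (n : ℝ) + 1 / 2 = v at h4
  field_simp

theorem HasJet.congr_coeff {F : ℝ → ℝ} {a b c a' b' c' : ℝ} (h : HasJet F a b c) (ha : a = a')
    (hb : b = b') (hc : c = c') : HasJet F a' b' c' := by
  subst ha hb hc
  exact h

/-- The first-order term is a second difference of `alphaSum`, hence the difference of two
consecutive α's. -/
theorem hasJet_jacobiCoeff_sq (n : ℕ) : HasJet (fun q => jacobiCoeff (momentFunctional q⁻¹) n ^ 2)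
    ((n + 1) * (n + 1 / 2)) ((n + 1) * (n + 1 / 2) * (2 * √2 * (alpha (n + 1) - alpha n)))
    ((n + 1) * (n + 1 / 2) * (2 * √2 * (alpha (n + 1) - alpha n) + 2 * alphaSum (n + 2) ^ 2
      - 8 * (n + 2) ^ 2 * alpha (n + 2) ^ 2 + 8 * alphaSum (n + 2) * alphaSum n
      + 2 * alphaSum n ^ 2 - 8 * n ^ 2 * alpha n ^ 2
      - 16 * alphaSum (n + 1) * (alphaSum (n + 2) + alphaSum n) + 20 * alphaSum (n + 1) ^ 2
      + 16 * (n + 1) ^ 2 * alpha (n + 1) ^ 2)) := by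
  have h2 : √2 ^ 2 = (2 : ℝ) := Real.sq_sqrt (by norm_num)
  have N0 := hasJet_normalizedGram n
  have N1 := hasJet_normalizedGram (n + 1)
  have N2 := hasJet_normalizedGram (n + 2)
  have I1 := HasJet.inv ((N1.mul N1).congr_coeff (mul_one 1) rfl rfl)
  have h := ((N2.mul N0).mul I1).const_mul (((n : ℝ) + 1) * (n + 1 / 2))
  refine HasJet.congr_coeff (CongrCube.congr_left h (eventually_jacobiCoeff_sq n)) (by ring) ?_ ?_
  · simp only [alphaSum_succ]
    ring
  · simp only [alphaSum_succ]
    push_cast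
    linear_combination (((n : ℝ) + 1) * (n + 1 / 2) * 4 *
      ((alphaSum n + alpha n + alpha (n + 1)) * alphaSum n
        - 2 * (alphaSum n + alpha n) * (alphaSum n + alpha n + alpha (n + 1) + alphaSum n)
        + 3 * (alphaSum n + alpha n) ^ 2)) * h2

/-! ### The expansion of the diagonal entries -/

/-- The real number `-i d_n`. -/
noncomputable def diagReal (n : ℕ) (q : ℝ) : ℝ :=
  -2 * n - 1 / 2 + jacobiCoeff (momentFunctional q⁻¹) n ^ 2
    - (if n = 0 then 0 else jacobiCoeff (momentFunctional q⁻¹) (n - 1) ^ 2)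

theorem neg_I_mul_dq (n : ℕ) (q : ℝ) : -Complex.I * dq n q = (diagReal n q : ℂ) := by
  rw [dq, neg_I_mul_diagEntry, diagReal]
  split_ifs <;> push_cast <;> ring

/-- Once the sums are expressed through `alphaSum n`, the terms quadratic in it cancel (2 + 8 + 2 -
32 + 20 = 0). The second coefficient is then linear in it, and `hY` trades it for Y. -/
theorem hasJet_diagReal (n : ℕ) {Y : ℝ} (hY : alpha n * Y = 1 / √2 - alphaSum n) :
    HasJet (diagReal n) 0 (-((16 * (n : ℝ) ^ 2 + 8 * n + 3) / √2) * alpha n)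
      ((8 * (n : ℝ) ^ 2 + 22 * n + 6 - (16 * (n : ℝ) ^ 2 + 8 * n + 3) * Y) * alpha n ^ 2) := by
  have h2 : √2 ^ 2 = (2 : ℝ) := Real.sq_sqrt (by norm_num)
  have hinv : 1 / √2 = √2 / 2 := by
    rw [div_eq_div_iff (by positivity) (by norm_num)]
    linear_combination -h2
  rw [hinv] at hY
  have hY2 : Y * alpha n ^ 2 = alpha n * (√2 / 2 - alphaSum n) := by rw [← hY]; ring
  have hδ : ((8 * (n : ℝ) ^ 2 + 22 * n + 6 - (16 * (n : ℝ) ^ 2 + 8 * n + 3) * Y) * alpha n ^ 2)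
      = (8 * (n : ℝ) ^ 2 + 22 * n + 6) * alpha n ^ 2
        - (16 * (n : ℝ) ^ 2 + 8 * n + 3) * (alpha n * (√2 / 2 - alphaSum n)) := by
    linear_combination (-(16 * (n : ℝ) ^ 2 + 8 * n + 3)) * hY2
  rw [hδ, div_eq_mul_one_div, hinv]
  rcases n with _ | n
  -- The case n = 0 is separate because a(-1) = 0 contributes nothing.
  · have h := (HasJet.const (-(1 / 2))).add (hasJet_jacobiCoeff_sq 0)
    refine HasJet.congr_coeff (CongrCube.congr_left h (Eventually.of_forall fun q => ?_)) ?_ ?_ ?_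
    · simp [diagReal]
    · norm_num
    · norm_num [alpha_succ, alpha_zero, alphaSum]
      ring
    · norm_num [alpha_succ, alpha_zero, alphaSum, Finset.sum_range_succ]
      ring
  · have h := ((HasJet.const (-2 * ((n + 1 : ℕ) : ℝ) - 1 / 2)).add
      (hasJet_jacobiCoeff_sq (n + 1))).sub (hasJet_jacobiCoeff_sq n)
    have n1 : (n : ℝ) + 1 ≠ 0 := by positivity
    have n2 : (n : ℝ) + 2 ≠ 0 := by positivity
    have n3 : (n : ℝ) + 3 ≠ 0 := by positivity
    have a1 := alpha_succ n
    have a2 : alpha (n + 2) = alpha n * ((n + 1 / 2) / (n + 1)) * ((n + 3 / 2) / (n + 2)) := by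
      rw [alpha_succ (n + 1), a1]
      push_cast
      field_simp
      ring
    have a3 : alpha (n + 3) = -(alpha n * ((n + 1 / 2) / (n + 1)) * ((n + 3 / 2) / (n + 2))
        * ((n + 5 / 2) / (n + 3))) := by
      rw [alpha_succ (n + 2), a2]
      push_cast
      field_simp
      ring
    refine HasJet.congr_coeff (CongrCube.congr_left h (Eventually.of_forall fun q => ?_)) ?_ ?_ ?_
    · simp [diagReal]
    · push_cast
      ring
    · rw [a1, show n + 1 + 1 = n + 2 by ring, a2]
      push_cast
      field_simp
      ring
    · simp only [show n + 1 + 1 = n + 2 by ring, show n + 1 + 2 = n + 3 by ring, alphaSum_succ]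
      rw [a1, a2, a3]
      push_cast
      field_simp
      ring

end SemilocalJacobi

theorem mainTheorem11 (n : ℕ) :
    -- `Y` is the value of the (conditionally convergent) series `₂F₁(1, n + 1/2; n + 1; -1)`
    ∃ Y : ℝ,
      Tendsto (fun K : ℕ => ∑ k ∈ Finset.range K,
        SemilocalJacobi.hypergeomTerm 1 ((n : ℝ) + 1 / 2) ((n : ℝ) + 1) (-1) k) atTop (𝓝 Y) ∧
      -- the `q`-expansion of `-i d_n` and its first coefficients
      (∃ δ : ℕ → ℝ,
        (∃ r : ℝ, 0 < r ∧ ∀ q : ℝ, 0 < q → q < r →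
          HasSum (fun j : ℕ => ((δ j * q ^ j : ℝ) : ℂ))
            (-Complex.I * SemilocalJacobi.dq n q)) ∧
        δ 0 = 0 ∧
        δ 1 = -((16 * (n : ℝ) ^ 2 + 8 * n + 3) / √2) * SemilocalJacobi.alpha n ∧
        δ 2 = (8 * (n : ℝ) ^ 2 + 22 * n + 6 - (16 * (n : ℝ) ^ 2 + 8 * n + 3) * Y)
          * SemilocalJacobi.alpha n ^ 2) ∧
      -- the expansion with remainder
      (fun q : ℝ => -Complex.I * SemilocalJacobi.dq n q -
          ((-((16 * (n : ℝ) ^ 2 + 8 * n + 3) / √2) * SemilocalJacobi.alpha n * q +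
            (8 * (n : ℝ) ^ 2 + 22 * n + 6 - (16 * (n : ℝ) ^ 2 + 8 * n + 3) * Y)
              * SemilocalJacobi.alpha n ^ 2 * q ^ 2 : ℝ) : ℂ))
        =O[𝓝[>] (0 : ℝ)] (fun q : ℝ => q ^ 3) := by
  have hY := SemilocalJacobi.tendsto_sum_hypergeomTerm n
  set Y := (1 / √2 - ∑ i ∈ Finset.range n, SemilocalJacobi.alpha i) / SemilocalJacobi.alpha n
    with hYdef
  have hJ := SemilocalJacobi.hasJet_diagReal n (Y := Y) (by
    rw [hYdef, mul_div_cancel₀ _ (SemilocalJacobi.alpha_ne_zero n), SemilocalJacobi.alphaSum])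
  refine ⟨Y, hY, ?_, ?_⟩
  · obtain ⟨δ, ⟨r, hr, hsum⟩, h0, h1, h2⟩ := hJ.exists_hasSum
    refine ⟨δ, ⟨r, hr, fun q hq hqr => ?_⟩, h0, h1, h2⟩
    rw [SemilocalJacobi.neg_I_mul_dq]
    exact Complex.hasSum_ofReal.mpr (hsum q hq hqr)
  · simp only [SemilocalJacobi.neg_I_mul_dq, ← Complex.ofReal_sub]
    refine Asymptotics.IsBigO.trans (Asymptotics.isBigO_of_le _ fun q => ?_) hJ.isBigO
    rw [Complex.norm_real, zero_add]
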